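/- Let $S$ be an inverse semigroup with zero, ordered by its natural partial order ($a\le b$ iff $a=be$ for some idempotent $e$); write $a^{\downarrow}=\{x\in S: x\le a\}$, and for $C\subseteq S$ let $C^{\downarrow}=\bigcup_{c\in C}c^{\downarrow}$. Assume that $S$ satisfies the weak meet condition: for all $a,b\in S$ there is a finite set $C\subseteq S$ with $a^{\downarrow}\cap b^{\downarrow}=C^{\downarrow}$. A proper filter is a nonempty, upward closed, downward directed subset of $S$ not containing $0$; an ultrafilter is a maximal proper filter. Let $\mathsf G_u(S)$ be the set of all proper filters with the patch topology, whose basic open sets are $U_{x;x_1,\dots,x_n}=\{F: x\in F,\ x_1,\dots,x_n\notin F\}$ for $x_1,\dots,x_n\le x$ in $S$, $n\ge 0$. Let $\mathsf G_m(S)\subseteq \mathsf G_u(S)$ be the subspace of all ultrafilters, $V_{x;x_1,\dots,x_n}=U_{x;x_1,\dots,x_n}\cap\mathsf G_m(S)$ and $V_x=U_x\cap \mathsf G_m(S)$. The compactness condition on $S$ says that $\mathsf G_m(S)$ is closed in $\mathsf G_u(S)$. Tight completion. A tight covering of $a$ is a finite set $X\subseteq a^{\downarrow}$ such that for every $0\ne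 x\le a$ there are $b\in X$ and $z\neq 0$ with $z\le x$ and $z\le b$. Let $\mathbf S$ be the quotient of $S$ by the congruence that identifies $a$ and $b$ iff they have a common tight covering. Elements $s,t$ are compatible if $s^{-1}t$ and $st^{-1}$ are idempotent. The tight closure of $A\subseteq\mathbf S$ is the set of all elements of $\mathbf S$ that have a tight covering contained in $A$, and $A$ is tightly closed if it equals its tight closure. The tightly closed order ideals of $\mathbf S$ whose elements are pairwise compatible form an inverse semigroup, the product of $A$ and $B$ being the tight closure of $AB$. An element $a$ of this semigroup is finite if, whenever $a\le \bigvee X$ for a compatible set $X$, already $a\le\bigvee Y$ for some finite $Y\subseteq X$. The tight completion $\mathsf D_t(S)$ is the inverse semigroup of finite elements. An inverse semigroup is called boolean if every finite compatible subset has a join, multiplication distributes on both sides over the finite joins that exist, the idempotents form a generalized boolean algebra under the natural partial order, and every two elements have a meet. Then the following are equivalent: 1. $S$ satisfies the compactness condition. 2. For every $x\in S$ the set $V_x$ is compact. 3. For all $x_1,\dots,x_n\le x$ in $S$ the set $V_{x;x_1,\dots,x_n}$ is compact. 4. For all idempotents $e,f_1,\dots,f_n$ of $S$ with $f_j\le e$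 for all $j$ there are finitely many idempotents $e_1,\dots,e_m\le e$ with $V_{e;f_1,\dots,f_n}=\bigcup_{k=1}^m V_{e_k}$. 5. For all idempotents $e,f$ of $S$ with $f\le e$ and $V_{e;f}\ne\emptyset$ there are finitely many idempotents $e_1,\dots,e_m\le e$ with $V_{e;f}=\bigcup_{k=1}^m V_{e_k}$. 6. The tight completion $\mathsf D_t(S)$ is boolean. -/

import Mathlib

/-- An inverse semigroup with zero: every element `a` has exactly one inverse `a⁻¹`, that is, exactly
one `b` with `a * b * a = a` and `b * a * b = b`. -/
class InverseSemigroupWithZero (S : Type*) extends SemigroupWithZero S, Inv S where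
  protected mul_inv_mul : ∀ a : S, a * a⁻¹ * a = a
  protected inv_mul_inv : ∀ a : S, a⁻¹ * a * a⁻¹ = a⁻¹
  protected eq_inv_of_mul : ∀ a b : S, a * b * a = a → b * a * b = b → b = a⁻¹

namespace InvSem

section Basic

variable {S : Type*} [InverseSemigroupWithZero S]

theorem mul_inv_mul (a : S) : a * a⁻¹ * a = a := InverseSemigroupWithZero.mul_inv_mul a

theorem inv_mul_inv (a : S) : a⁻¹ * a * a⁻¹ = a⁻¹ := InverseSemigroupWithZero.inv_mul_inv a

theorem eq_inv {a b : S} (h : a * b * a = a) (h' : b * a * b = b) : b = a⁻¹ :=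
  InverseSemigroupWithZero.eq_inv_of_mul a b h h'

theorem inv_inv (a : S) : a⁻¹⁻¹ = a := (eq_inv (inv_mul_inv a) (mul_inv_mul a)).symm

theorem idem_mul {e f : S} (he : IsIdempotentElem e) (hf : IsIdempotentElem f) :
    IsIdempotentElem (e * f) := by
  unfold IsIdempotentElem at *
  have h1 := mul_inv_mul (e * f)
  have h2 := inv_mul_inv (e * f)
  set x := (e * f)⁻¹ with hx
  have hy : f * x * e = x := eq_inv (by grind) (by grind)
  have hxx : x * x = x := by grind
  have h3 : e * f = x⁻¹ := eq_inv h2 h1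
  have h4 : x = x⁻¹ := eq_inv (by grind) (by grind)
  grind

theorem idem_comm {e f : S} (he : IsIdempotentElem e) (hf : IsIdempotentElem f) :
    e * f = f * e := by
  have h1 := idem_mul he hf
  have h2 := idem_mul hf he
  unfold IsIdempotentElem at *
  have h3 : f * e = (e * f)⁻¹ := eq_inv (by grind) (by grind)
  have h4 : e * f = (e * f)⁻¹ := eq_inv (by grind) (by grind)
  rw [h4, ← h3]

theorem idem_inv {e : S} (he : IsIdempotentElem e) : e⁻¹ = e :=
  (eq_inv (by rw [he.eq, he.eq]) (by rw [he.eq, he.eq])).symm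

theorem idem_inv_mul (a : S) : IsIdempotentElem (a⁻¹ * a) := by
  have := mul_inv_mul a
  unfold IsIdempotentElem; grind

theorem idem_mul_inv (a : S) : IsIdempotentElem (a * a⁻¹) := by
  have := mul_inv_mul a
  unfold IsIdempotentElem; grind

theorem mul_inv_rev (a b : S) : (a * b)⁻¹ = b⁻¹ * a⁻¹ := by
  have h := idem_comm (idem_mul_inv b) (idem_inv_mul a)
  have := mul_inv_mul a
  have := mul_inv_mul b
  have := inv_mul_inv a
  have := inv_mul_inv b
  symm
  apply eq_inv
  · calc a * b * (b⁻¹ * a⁻¹) * (a * b) = a * ((b * b⁻¹) * (a⁻¹ * a)) * b := by simp only [mul_assoc]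
      _ = (a * a⁻¹ * a) * (b * b⁻¹ * b) := by rw [h]; simp only [mul_assoc]
      _ = a * b := by rw [mul_inv_mul, mul_inv_mul]
  · calc b⁻¹ * a⁻¹ * (a * b) * (b⁻¹ * a⁻¹) = b⁻¹ * ((a⁻¹ * a) * (b * b⁻¹)) * a⁻¹ := by
          simp only [mul_assoc]
      _ = (b⁻¹ * b * b⁻¹) * (a⁻¹ * a * a⁻¹) := by rw [← h]; simp only [mul_assoc]
      _ = b⁻¹ * a⁻¹ := by rw [inv_mul_inv, inv_mul_inv]

theorem idem_conj (a : S) {e : S} (he : IsIdempotentElem e) : IsIdempotentElem (a * e * a⁻¹) := by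
  have h := idem_comm he (idem_inv_mul a)
  have h1 := mul_inv_mul a
  unfold IsIdempotentElem at *
  calc a * e * a⁻¹ * (a * e * a⁻¹) = a * (e * (a⁻¹ * a)) * e * a⁻¹ := by simp only [mul_assoc]
    _ = (a * a⁻¹ * a) * (e * e) * a⁻¹ := by rw [h]; simp only [mul_assoc]
    _ = a * e * a⁻¹ := by rw [h1, he]

theorem mul_idem_eq (b : S) {e : S} (he : IsIdempotentElem e) : b * e = b * e * b⁻¹ * b := by
  have h := idem_comm he (idem_inv_mul b)
  calc b * e = (b * b⁻¹ * b) * e := by rw [mul_inv_mul]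
    _ = b * ((b⁻¹ * b) * e) := by simp only [mul_assoc]
    _ = b * e * b⁻¹ * b := by rw [← h]; simp only [mul_assoc]

theorem idem_mul_eq (b : S) {e : S} (he : IsIdempotentElem e) : e * b = b * (b⁻¹ * e * b) := by
  have h := idem_comm he (idem_mul_inv b)
  calc e * b = e * (b * b⁻¹ * b) := by rw [mul_inv_mul]
    _ = (e * (b * b⁻¹)) * b := by simp only [mul_assoc]
    _ = b * (b⁻¹ * e * b) := by rw [h]; simp only [mul_assoc]

theorem eq_mul_of_eq {a b e : S} (he : IsIdempotentElem e) (h : a = b * e) :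
    a = b * (a⁻¹ * a) := by
  have h1 : a * e = a := by rw [h, mul_assoc, he.eq]
  have h2 := idem_comm he (idem_inv_mul a)
  calc a = a * (a⁻¹ * a) := by rw [← mul_assoc, mul_inv_mul]
    _ = b * (e * (a⁻¹ * a)) := by rw [← mul_assoc b, ← h]
    _ = b * (a⁻¹ * (a * e)) := by rw [h2]; simp only [mul_assoc]
    _ = b * (a⁻¹ * a) := by rw [h1]

/-- The natural partial order of an inverse semigroup. -/
instance natPartialOrder : PartialOrder S where
  le a b := ∃ e, IsIdempotentElem e ∧ a = b * e
  le_refl a := ⟨a⁻¹ * a, idem_inv_mul a, by rw [← mul_assoc, mul_inv_mul]⟩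
  le_trans := by
    rintro a b c ⟨e, he, rfl⟩ ⟨f, hf, rfl⟩
    exact ⟨f * e, idem_mul hf he, mul_assoc _ _ _⟩
  le_antisymm := by
    rintro a b ⟨e, he, h⟩ ⟨f, hf, h'⟩
    have h1 : a * e = a := by rw [h, mul_assoc, he.eq]
    calc a = b * e := h
      _ = a * (f * e) := by rw [← mul_assoc, ← h']
      _ = a * e * f := by rw [idem_comm hf he, mul_assoc]
      _ = b := by rw [h1, ← h']

theorem le_def {a b : S} : a ≤ b ↔ ∃ e, IsIdempotentElem e ∧ a = b * e := Iff.rfl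

theorem le_iff {a b : S} : a ≤ b ↔ a = b * (a⁻¹ * a) :=
  ⟨fun ⟨_, he, h⟩ => eq_mul_of_eq he h, fun h => ⟨_, idem_inv_mul a, h⟩⟩

theorem le_iff_left {a b : S} : a ≤ b ↔ ∃ e, IsIdempotentElem e ∧ a = e * b := by
  constructor
  · rintro ⟨e, he, rfl⟩
    exact ⟨_, idem_conj b he, mul_idem_eq b he⟩
  · rintro ⟨e, he, rfl⟩
    refine ⟨b⁻¹ * e * b, ?_, idem_mul_eq b he⟩
    have := idem_conj b⁻¹ he
    rwa [inv_inv] at this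

theorem mul_idem_le (b : S) {e : S} (he : IsIdempotentElem e) : b * e ≤ b := ⟨e, he, rfl⟩

theorem idem_mul_le (b : S) {e : S} (he : IsIdempotentElem e) : e * b ≤ b :=
  le_iff_left.2 ⟨e, he, rfl⟩

theorem mul_le_mul {a b c d : S} (h : a ≤ b) (h' : c ≤ d) : a * c ≤ b * d := by
  obtain ⟨e, he, rfl⟩ := h
  obtain ⟨f, hf, rfl⟩ := h'
  calc b * e * (d * f) = b * (e * d) * f := by simp only [mul_assoc]
    _ ≤ b * (e * d) := mul_idem_le _ hf
    _ ≤ b * d := by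
      obtain ⟨g, hg, h⟩ := idem_mul_le d he
      rw [h, ← mul_assoc]
      exact mul_idem_le _ hg

theorem inv_le_inv {a b : S} (h : a ≤ b) : a⁻¹ ≤ b⁻¹ := by
  obtain ⟨e, he, rfl⟩ := h
  rw [mul_inv_rev, idem_inv he]
  exact idem_mul_le _ he

theorem idem_of_le {a e : S} (h : a ≤ e) (he : IsIdempotentElem e) : IsIdempotentElem a := by
  obtain ⟨f, hf, rfl⟩ := h
  exact idem_mul he hf

theorem zero_le (a : S) : 0 ≤ a := ⟨0, mul_zero 0, (mul_zero a).symm⟩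

theorem eq_zero_of_le {a : S} (h : a ≤ 0) : a = 0 := le_antisymm h (zero_le a)

theorem zero_inv : (0 : S)⁻¹ = 0 := idem_inv (mul_zero 0)

/-- Two elements are compatible if `s⁻¹ * t` and `s * t⁻¹` are idempotents. -/
def Compatible (s t : S) : Prop := IsIdempotentElem (s⁻¹ * t) ∧ IsIdempotentElem (s * t⁻¹)

/-- A subset is compatible if its elements are pairwise compatible. -/
def IsCompatible (A : Set S) : Prop := ∀ s ∈ A, ∀ t ∈ A, Compatible s t

theorem IsCompatible.mono {A B : Set S} (h : IsCompatible B) (hAB : A ⊆ B) : IsCompatible A :=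
  fun s hs t ht => h s (hAB hs) t (hAB ht)

theorem isCompatible_Iic (a : S) : IsCompatible (Set.Iic a) := by
  intro s hs t ht
  refine ⟨idem_of_le (mul_le_mul (inv_le_inv hs) ht) (idem_inv_mul a),
    idem_of_le (mul_le_mul hs (inv_le_inv ht)) (idem_mul_inv a)⟩

/-- The tight coverings of `a`: the finite subsets `X` of the principal order ideal generated by `a`
such that every nonzero element below `a` has a nonzero lower bound in common with some member of
`X`. -/
def IsTightCover (X : Set S) (a : S) : Prop :=
  X.Finite ∧ X ⊆ Set.Iic a ∧ ∀ x ≤ a, x ≠ 0 → ∃ b ∈ X, ∃ z, z ≠ 0 ∧ z ≤ x ∧ z ≤ b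

open scoped Pointwise

theorem isTightCover_singleton (a : S) : IsTightCover {a} a :=
  ⟨Set.finite_singleton a, by simp, fun x hx h0 => ⟨a, rfl, x, h0, le_rfl, hx⟩⟩

theorem isTightCover_empty : IsTightCover (∅ : Set S) 0 :=
  ⟨Set.finite_empty, by simp, fun x hx h0 => absurd (eq_zero_of_le hx) h0⟩

theorem IsTightCover.mul {X Y : Set S} {a b : S} (hX : IsTightCover X a) (hY : IsTightCover Y b) :
    IsTightCover (X * Y) (a * b) := by
  refine ⟨hX.1.mul hY.1, ?_, ?_⟩
  · rintro _ ⟨x, hx, y, hy, rfl⟩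
    exact mul_le_mul (hX.2.1 hx) (hY.2.1 hy)
  · intro z hz h0
    have hz1 : a * (a⁻¹ * z) = z := by
      obtain ⟨e, he, rfl⟩ := hz
      rw [← mul_assoc, ← mul_assoc, ← mul_assoc, mul_inv_mul]
    obtain ⟨y, hy, u, hu0, hu, huy⟩ := hY.2.2 (a⁻¹ * z) (by
      calc a⁻¹ * z ≤ a⁻¹ * (a * b) := mul_le_mul le_rfl hz
        _ = (a⁻¹ * a) * b := by rw [mul_assoc]
        _ ≤ b := idem_mul_le _ (idem_inv_mul a)) (by
        intro h; apply h0; rw [← hz1, h, mul_zero])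
    have hu1 : a⁻¹ * (a * u) = u := by
      obtain ⟨e, he, rfl⟩ := hu
      rw [← mul_assoc a, ← mul_assoc a, ← mul_assoc a⁻¹, ← mul_assoc a⁻¹, ← mul_assoc a⁻¹,
        inv_mul_inv]
    have hu2 : a * u * y⁻¹ * y = a * u := by
      obtain ⟨e, he, rfl⟩ := huy
      calc a * (y * e) * y⁻¹ * y = a * y * (e * (y⁻¹ * y)) := by simp only [mul_assoc]
        _ = a * (y * y⁻¹ * y) * e := by
          rw [idem_comm he (idem_inv_mul y)]; simp only [mul_assoc]
        _ = a * (y * e) := by rw [mul_inv_mul, mul_assoc]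
    have hau : a * u ≠ 0 := by
      intro h; apply hu0; rw [← hu1, h, mul_zero]
    obtain ⟨x, hx, v, hv0, hv, hvx⟩ := hX.2.2 (a * u * y⁻¹) (by
      calc a * u * y⁻¹ ≤ a * y * y⁻¹ := mul_le_mul (mul_le_mul le_rfl huy) le_rfl
        _ = a * (y * y⁻¹) := mul_assoc _ _ _
        _ ≤ a := mul_idem_le _ (idem_mul_inv y)) (by
        intro h; apply hau; rw [← hu2, h, zero_mul])
    have hv1 : v * y * y⁻¹ = v := by
      obtain ⟨e, he, rfl⟩ := le_iff_left.1 hv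
      have := inv_mul_inv y
      grind
    refine ⟨x * y, Set.mul_mem_mul hx hy, v * y, ?_, ?_, mul_le_mul hvx le_rfl⟩
    · intro h; apply hv0; rw [← hv1, h, zero_mul]
    · calc v * y ≤ a * u * y⁻¹ * y := mul_le_mul hv le_rfl
        _ = a * u := hu2
        _ ≤ a * (a⁻¹ * z) := mul_le_mul le_rfl hu
        _ = z := hz1

theorem IsTightCover.trans {X : Set S} {a : S} (hX : IsTightCover X a) {Y : S → Set S}
    (hY : ∀ x ∈ X, IsTightCover (Y x) x) : IsTightCover (⋃ x ∈ X, Y x) a := by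
  refine ⟨hX.1.biUnion fun x hx => (hY x hx).1, ?_, ?_⟩
  · refine Set.iUnion₂_subset fun x hx y hy => ?_
    exact le_trans (b := x) ((hY x hx).2.1 hy) (hX.2.1 hx)
  · intro z hz h0
    obtain ⟨x, hx, u, hu0, huz, hux⟩ := hX.2.2 z hz h0
    obtain ⟨y, hy, v, hv0, hvu, hvy⟩ := (hY x hx).2.2 u hux hu0
    exact ⟨y, Set.mem_biUnion hx hy, v, hv0, hvu.trans huz, hvy⟩

theorem IsTightCover.inv {X : Set S} {a : S} (hX : IsTightCover X a) :
    IsTightCover ((fun x => x⁻¹) '' X) a⁻¹ := by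
  refine ⟨hX.1.image _, ?_, ?_⟩
  · rintro _ ⟨x, hx, rfl⟩
    exact inv_le_inv (hX.2.1 hx)
  · intro z hz h0
    have hz' := inv_le_inv hz
    rw [inv_inv] at hz'
    obtain ⟨x, hx, u, hu0, huz, hux⟩ := hX.2.2 z⁻¹ hz' (by
      intro h; apply h0; rw [← inv_inv z, h, zero_inv])
    refine ⟨_, ⟨x, hx, rfl⟩, u⁻¹, ?_, ?_, inv_le_inv hux⟩
    · intro h; apply hu0; rw [← inv_inv u, h, zero_inv]
    · have := inv_le_inv huz
      rwa [inv_inv] at this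

/-- If `X` covers `a` and `X, Y` cover `b`, then `Y` cut down by the domains of `X` covers `a`. -/
theorem IsTightCover.common {X Y : Set S} {a b c : S} (hXa : IsTightCover X a)
    (hXb : IsTightCover X b) (hYb : IsTightCover Y b) (hYc : IsTightCover Y c) :
    ∃ Z, IsTightCover Z a ∧ IsTightCover Z c := by
  have key : ∀ {X Y : Set S} {a b : S}, IsTightCover X a → IsTightCover X b → IsTightCover Y b →
      IsTightCover (⋃ x ∈ X, Y * {x⁻¹ * x}) a := by
    intro X Y a b hXa hXb hYb
    refine hXa.trans (Y := fun x => Y * {x⁻¹ * x}) fun x hx => ?_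
    have := hYb.mul (isTightCover_singleton (x⁻¹ * x))
    rwa [← le_iff.1 (hXb.2.1 hx)] at this
  refine ⟨_, key hXa hXb hYb, ?_⟩
  have h2 := key hYc hYb hXb
  convert h2 using 1
  have hc : ∀ x ∈ X, ∀ y ∈ Y, y * (x⁻¹ * x) = x * (y⁻¹ * y) := by
    intro x hx y hy
    have h1 := le_iff.1 (hXb.2.1 hx)
    have h3 := le_iff.1 (hYb.2.1 hy)
    calc y * (x⁻¹ * x) = b * ((y⁻¹ * y) * (x⁻¹ * x)) := by rw [← mul_assoc b (y⁻¹ * y), ← h3]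
      _ = b * (x⁻¹ * x) * (y⁻¹ * y) := by
        rw [idem_comm (idem_inv_mul y) (idem_inv_mul x), ← mul_assoc b]
      _ = x * (y⁻¹ * y) := by rw [← h1]
  ext z
  simp only [Set.mem_iUnion, Set.mul_singleton, Set.mem_image]
  constructor
  · rintro ⟨x, hx, y, hy, rfl⟩
    exact ⟨y, hy, x, hx, (hc x hx y hy).symm⟩
  · rintro ⟨y, hy, x, hx, rfl⟩
    exact ⟨x, hx, y, hy, hc x hx y hy⟩

variable (S) in
/-- The congruence relating two elements that have a tight covering in common. -/
def tightCon : Con S where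
  r a b := ∃ X, IsTightCover X a ∧ IsTightCover X b
  iseqv :=
    ⟨fun a => ⟨{a}, isTightCover_singleton a, isTightCover_singleton a⟩,
      fun ⟨X, h, h'⟩ => ⟨X, h', h⟩,
      fun ⟨_, h1, h2⟩ ⟨_, h3, h4⟩ => h1.common h2 h3 h4⟩
  mul' := fun ⟨X, h1, h2⟩ ⟨Y, h3, h4⟩ => ⟨X * Y, h1.mul h3, h2.mul h4⟩

theorem tightCon_def {a b : S} :
    tightCon S a b ↔ ∃ X, IsTightCover X a ∧ IsTightCover X b := Iff.rfl

variable (S) in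
/-- The quotient of `S` by the congruence `tightCon S`. -/
def TightQuotient : Type _ := (tightCon S).Quotient

/-- The quotient map. -/
def TightQuotient.mk (a : S) : TightQuotient S := (a : (tightCon S).Quotient)

instance : SemigroupWithZero (TightQuotient S) where
  __ := (inferInstance : Semigroup (tightCon S).Quotient)
  zero := TightQuotient.mk 0
  zero_mul a := by
    induction a using Con.induction_on with
    | H a => exact congrArg TightQuotient.mk (zero_mul a)
  mul_zero a := by
    induction a using Con.induction_on with
    | H a => exact congrArg TightQuotient.mk (mul_zero a)

namespace TightQuotient

theorem mk_surjective : Function.Surjective (mk : S → TightQuotient S) :=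
  fun a => Con.induction_on a fun a => ⟨a, rfl⟩

theorem mk_eq {a b : S} : mk a = mk b ↔ ∃ X, IsTightCover X a ∧ IsTightCover X b :=
  (Con.eq (tightCon S)).trans tightCon_def

theorem mk_mul (a b : S) : mk (a * b) = mk a * mk b := rfl

theorem mk_zero : mk (0 : S) = 0 := rfl

theorem mk_eq_zero {a : S} : mk a = 0 ↔ a = 0 := by
  constructor
  · intro h
    obtain ⟨X, h1, h2⟩ := mk_eq.1 (h.trans mk_zero.symm)
    by_contra h0
    obtain ⟨b, hb, z, hz0, hza, hzb⟩ := h1.2.2 a le_rfl h0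
    exact hz0 (eq_zero_of_le (hzb.trans (h2.2.1 hb)))
  · rintro rfl; rfl

/-- Every idempotent of the quotient is the class of an idempotent. -/
theorem exists_idem {e : TightQuotient S} (he : IsIdempotentElem e) :
    ∃ f : S, IsIdempotentElem f ∧ mk f = e := by
  obtain ⟨a, rfl⟩ := mk_surjective e
  refine ⟨a * a⁻¹ * (a⁻¹ * a), idem_mul (idem_mul_inv a) (idem_inv_mul a), ?_⟩
  have he' : mk a * mk a = mk a := he
  have h1 : mk a * mk a⁻¹ * mk a = mk a := by rw [← mk_mul, ← mk_mul, mul_inv_mul]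
  have h2 : mk a⁻¹ * mk a * mk a⁻¹ = mk a⁻¹ := by rw [← mk_mul, ← mk_mul, inv_mul_inv]
  have h3 : mk (a⁻¹ * (a * a) * a⁻¹) = mk a⁻¹ := by
    rw [mk_mul, mk_mul, mk_mul, he', h2]
  have h4 : mk (a⁻¹ * a) * mk (a * a⁻¹) = mk a⁻¹ := by
    rw [← mk_mul, ← h3]; congr 1; simp only [mul_assoc]
  have h5 : mk (a * a⁻¹ * (a⁻¹ * a)) = mk a⁻¹ := by
    rw [← h4, ← mk_mul, idem_comm (idem_mul_inv a) (idem_inv_mul a)]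
  have h6 : mk a⁻¹ * mk a⁻¹ = mk a⁻¹ := by
    rw [← h5]
    exact congrArg mk (idem_mul (idem_mul_inv a) (idem_inv_mul a)).eq
  rw [h5]
  have h7 : mk a * mk a⁻¹ * (mk a⁻¹ * mk a) = mk a := by
    calc mk a * mk a⁻¹ * (mk a⁻¹ * mk a) = mk a * (mk a⁻¹ * mk a⁻¹) * mk a := by
          simp only [mul_assoc]
      _ = mk a := by rw [h6, h1]
  calc mk a⁻¹ = mk (a * a⁻¹ * (a⁻¹ * a)) := h5.symm
    _ = mk a := h7

theorem idem_mul_comm {e f : TightQuotient S} (he : IsIdempotentElem e)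
    (hf : IsIdempotentElem f) : e * f = f * e := by
  obtain ⟨e, he', rfl⟩ := exists_idem he
  obtain ⟨f, hf', rfl⟩ := exists_idem hf
  rw [← mk_mul, ← mk_mul, idem_comm he' hf']

end TightQuotient

/-- In a semigroup with commuting idempotents inverses are unique. -/
theorem eq_of_idem_comm {R : Type*} [Semigroup R]
    (hc : ∀ e f : R, IsIdempotentElem e → IsIdempotentElem f → e * f = f * e) {a b c : R}
    (h1 : a * b * a = a) (h2 : b * a * b = b) (h3 : a * c * a = a) (h4 : c * a * c = c) :
    b = c := by
  have e1 : a * b * (a * c) = a * c * (a * b) :=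
    hc _ _ (by unfold IsIdempotentElem; grind) (by unfold IsIdempotentElem; grind)
  have e2 : b * a * (c * a) = c * a * (b * a) :=
    hc _ _ (by unfold IsIdempotentElem; grind) (by unfold IsIdempotentElem; grind)
  grind

instance : InverseSemigroupWithZero (TightQuotient S) where
  inv := Quotient.map (fun a => a⁻¹) fun _ _ ⟨_, h1, h2⟩ => ⟨_, h1.inv, h2.inv⟩
  mul_inv_mul a := by
    obtain ⟨a, rfl⟩ := TightQuotient.mk_surjective a
    exact congrArg TightQuotient.mk (mul_inv_mul a)
  inv_mul_inv a := by
    obtain ⟨a, rfl⟩ := TightQuotient.mk_surjective a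
    exact congrArg TightQuotient.mk (inv_mul_inv a)
  eq_inv_of_mul a c h1 h2 := by
    obtain ⟨a, rfl⟩ := TightQuotient.mk_surjective a
    exact eq_of_idem_comm (fun e f => TightQuotient.idem_mul_comm) h1 h2
      (congrArg TightQuotient.mk (mul_inv_mul a)) (congrArg TightQuotient.mk (inv_mul_inv a))

namespace TightQuotient

theorem mk_inv (a : S) : mk a⁻¹ = (mk a)⁻¹ := rfl

theorem mk_le_mk {a b : S} (h : a ≤ b) : mk a ≤ mk b := by
  obtain ⟨e, he, rfl⟩ := h
  exact ⟨mk e, congrArg mk he, rfl⟩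

theorem exists_of_le_mk {x : TightQuotient S} {a : S} (h : x ≤ mk a) :
    ∃ c : S, mk c = x ∧ x = mk (a * (c⁻¹ * c)) := by
  obtain ⟨c, rfl⟩ := mk_surjective x
  exact ⟨c, rfl, le_iff.1 h⟩

/-- The quotient is separative: an element is determined by any one of its tight coverings. -/
theorem eq_of_isTightCover {X : Set (TightQuotient S)} {a b : TightQuotient S}
    (ha : IsTightCover X a) (hb : IsTightCover X b) : a = b := by
  obtain ⟨a, rfl⟩ := mk_surjective a
  obtain ⟨b, rfl⟩ := mk_surjective b
  have hcov : ∀ x : TightQuotient S, ∃ C : Set S, x ∈ X → ∃ c : S, x = mk (a * (c⁻¹ * c)) ∧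
      x = mk (b * (c⁻¹ * c)) ∧ IsTightCover C (a * (c⁻¹ * c)) ∧
        IsTightCover C (b * (c⁻¹ * c)) := by
    intro x
    by_cases hx : x ∈ X
    · obtain ⟨c, rfl⟩ := mk_surjective x
      have h1 : mk c = mk (a * (c⁻¹ * c)) := le_iff.1 (ha.2.1 hx)
      have h2 : mk c = mk (b * (c⁻¹ * c)) := le_iff.1 (hb.2.1 hx)
      obtain ⟨C, hC⟩ := mk_eq.1 (h1.symm.trans h2)
      exact ⟨C, fun _ => ⟨c, h1, h2, hC⟩⟩
    · exact ⟨∅, fun h => absurd h hx⟩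
  choose C hC using hcov
  have main : ∀ d : S, IsTightCover X (mk d) → (∀ x ∈ X, ∃ c : S, x = mk (d * (c⁻¹ * c)) ∧
      IsTightCover (C x) (d * (c⁻¹ * c))) → IsTightCover (⋃ x ∈ X, C x) d := by
    intro d hd hdC
    refine ⟨hd.1.biUnion fun x hx => ?_, Set.iUnion₂_subset fun x hx y hy => ?_, ?_⟩
    · obtain ⟨c, -, h⟩ := hdC x hx
      exact h.1
    · obtain ⟨c, -, h⟩ := hdC x hx
      exact le_trans (b := d * (c⁻¹ * c)) (h.2.1 hy) (mul_idem_le _ (idem_inv_mul c))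
    · intro z hz h0
      obtain ⟨x, hx, u, hu0, huz, hux⟩ := hd.2.2 (mk z) (mk_le_mk hz) (fun h => h0 (mk_eq_zero.1 h))
      obtain ⟨c, hxc, hCc⟩ := hdC x hx
      obtain ⟨v, rfl⟩ := mk_surjective u
      have h1 : mk v = mk (z * (v⁻¹ * v)) := le_iff.1 huz
      have h2 : mk v = mk (d * (c⁻¹ * c) * (v⁻¹ * v)) := by
        have := le_iff.1 hux
        rwa [hxc] at this
      obtain ⟨Y, hY1, hY2⟩ := mk_eq.1 (h1.symm.trans h2)
      obtain ⟨y, hy, w, hw0, -, hwy⟩ := hY1.2.2 _ le_rfl (fun h => hu0 (by rw [h1, h]; rfl))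
      have hwz : w ≤ z := hwy.trans ((hY1.2.1 hy : y ≤ _).trans (mul_idem_le _ (idem_inv_mul v)))
      have hwd : w ≤ d * (c⁻¹ * c) :=
        hwy.trans ((hY2.2.1 hy : y ≤ _).trans (mul_idem_le _ (idem_inv_mul v)))
      obtain ⟨b, hb, t, ht0, htw, htb⟩ := hCc.2.2 w hwd hw0
      exact ⟨b, Set.mem_biUnion hx hb, t, ht0, htw.trans hwz, htb⟩
  refine mk_eq.2 ⟨⋃ x ∈ X, C x, main a ha fun x hx => ?_, main b hb fun x hx => ?_⟩
  · obtain ⟨c, h1, h2, h3, h4⟩ := hC x hx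
    exact ⟨c, h1, h3⟩
  · obtain ⟨c, h1, h2, h3, h4⟩ := hC x hx
    exact ⟨c, h2, h4⟩

end TightQuotient

variable (S) in
/-- Separativity with respect to the tight coverage: an element is determined by any one of its
tight coverings. -/
class TightSeparative : Prop where
  eq_of_isTightCover : ∀ (X : Set S) (a b : S), IsTightCover X a → IsTightCover X b → a = b

instance : TightSeparative (TightQuotient S) :=
  ⟨fun _ _ _ => TightQuotient.eq_of_isTightCover⟩

/-- A set is tightly closed if it contains every element that has a tight covering inside the set. -/
def IsTightClosed (A : Set S) : Prop := ∀ X x, X ⊆ A → IsTightCover X x → x ∈ A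

/-- The set of all elements that have a tight covering inside `A`. -/
def tightClosure (A : Set S) : Set S := {x | ∃ X ⊆ A, IsTightCover X x}

theorem subset_tightClosure (A : Set S) : A ⊆ tightClosure A :=
  fun a ha => ⟨{a}, Set.singleton_subset_iff.2 ha, isTightCover_singleton a⟩

theorem tightClosure_mono {A B : Set S} (h : A ⊆ B) : tightClosure A ⊆ tightClosure B :=
  fun _ ⟨X, hX, hx⟩ => ⟨X, hX.trans h, hx⟩

theorem isTightClosed_tightClosure (A : Set S) : IsTightClosed (tightClosure A) := by
  intro X x hX hx
  have : ∀ y, ∃ Y : Set S, y ∈ X → Y ⊆ A ∧ IsTightCover Y y := by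
    intro y
    by_cases hy : y ∈ X
    · obtain ⟨Y, hY⟩ := hX hy
      exact ⟨Y, fun _ => hY⟩
    · exact ⟨∅, fun h => absurd h hy⟩
  choose Y hY using this
  exact ⟨⋃ y ∈ X, Y y, Set.iUnion₂_subset fun y hy => (hY y hy).1,
    hx.trans fun y hy => (hY y hy).2⟩

theorem IsTightClosed.tightClosure_subset {A B : Set S} (hB : IsTightClosed B) (h : A ⊆ B) :
    tightClosure A ⊆ B := fun x ⟨X, hX, hx⟩ => hB X x (hX.trans h) hx

theorem tightClosure_mul_subset (A B : Set S) :
    tightClosure A * tightClosure B ⊆ tightClosure (A * B) := by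
  rintro _ ⟨a, ⟨X, hX, ha⟩, b, ⟨Y, hY, hb⟩, rfl⟩
  exact ⟨X * Y, Set.mul_subset_mul hX hY, ha.mul hb⟩

theorem tightClosure_mul_left (A B : Set S) :
    tightClosure (tightClosure A * B) = tightClosure (A * B) :=
  ((isTightClosed_tightClosure _).tightClosure_subset
    ((Set.mul_subset_mul_left (subset_tightClosure B)).trans (tightClosure_mul_subset A B))).antisymm
    (tightClosure_mono (Set.mul_subset_mul_right (subset_tightClosure A)))

theorem tightClosure_mul_right (A B : Set S) :
    tightClosure (A * tightClosure B) = tightClosure (A * B) :=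
  ((isTightClosed_tightClosure _).tightClosure_subset
    ((Set.mul_subset_mul_right (subset_tightClosure A)).trans (tightClosure_mul_subset A B))).antisymm
    (tightClosure_mono (Set.mul_subset_mul_left (subset_tightClosure B)))

theorem isLowerSet_tightClosure {A : Set S} (hA : IsLowerSet A) : IsLowerSet (tightClosure A) := by
  rintro x y ⟨e, he, rfl⟩ ⟨X, hX, hx⟩
  refine ⟨X * {e}, ?_, hx.mul (isTightCover_singleton e)⟩
  rintro _ ⟨a, ha, _, rfl, rfl⟩
  exact hA (mul_idem_le a he) (hX ha)

theorem isIdempotentElem_of_mem_tightClosure [TightSeparative S] {A : Set S}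
    (hA : ∀ a ∈ A, IsIdempotentElem a) {x : S} (hx : x ∈ tightClosure A) :
    IsIdempotentElem x := by
  obtain ⟨X, hX, hx⟩ := hx
  have h1 := hx.mul (isTightCover_singleton x⁻¹)
  have h2 : X * {x⁻¹} = X := by
    have : ∀ e ∈ X, e * x⁻¹ = e := by
      intro e he
      have h1 := hA e (hX he)
      have h2 : e⁻¹ * e = e := by rw [idem_inv h1, h1.eq]
      have h3 : e⁻¹ = e⁻¹ * e * x⁻¹ := by
        have h4 := congrArg (fun y => y⁻¹) (le_iff.1 (hx.2.1 he))
        simp only [mul_inv_rev, inv_inv] at h4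
        exact h4
      rw [idem_inv h1, h1.eq] at h3
      exact h3.symm
    rw [Set.mul_singleton]
    exact (Set.image_congr this).trans (Set.image_id' X)
  rw [h2] at h1
  rw [TightSeparative.eq_of_isTightCover X x _ hx h1]
  exact idem_mul_inv x

theorem isCompatible_tightClosure [TightSeparative S] {A : Set S} (hA : IsCompatible A) :
    IsCompatible (tightClosure A) := by
  rintro a ⟨X, hX, ha⟩ b ⟨Y, hY, hb⟩
  constructor
  · refine isIdempotentElem_of_mem_tightClosure (A := (fun x => x⁻¹) '' X * Y) ?_
      ⟨_, subset_rfl, ha.inv.mul hb⟩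
    rintro _ ⟨_, ⟨x, hx, rfl⟩, y, hy, rfl⟩
    exact (hA x (hX hx) y (hY hy)).1
  · refine isIdempotentElem_of_mem_tightClosure (A := X * (fun x => x⁻¹) '' Y) ?_
      ⟨_, subset_rfl, ha.mul hb.inv⟩
    rintro _ ⟨x, hx, _, ⟨y, hy, rfl⟩, rfl⟩
    exact (hA x (hX hx) y (hY hy)).2

theorem isLowerSet_mul {A B : Set S} (hB : IsLowerSet B) : IsLowerSet (A * B) := by
  rintro _ y ⟨e, he, rfl⟩ ⟨a, ha, b, hb, rfl⟩
  exact ⟨a, ha, b * e, hB (mul_idem_le b he) hb, (mul_assoc a b e).symm⟩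

theorem isCompatible_mul {A B : Set S} (hA : IsCompatible A) (hB : IsCompatible B) :
    IsCompatible (A * B) := by
  rintro _ ⟨a, ha, b, hb, rfl⟩ _ ⟨c, hc, d, hd, rfl⟩
  simp only [Compatible, mul_inv_rev]
  constructor
  · have h : b⁻¹ * a⁻¹ * (c * d) = b⁻¹ * (a⁻¹ * c * d) := by simp only [mul_assoc]
    rw [h]
    exact idem_of_le (mul_le_mul le_rfl (idem_mul_le d (hA a ha c hc).1)) (hB b hb d hd).1
  · have h : a * b * (d⁻¹ * c⁻¹) = a * (b * d⁻¹) * c⁻¹ := by simp only [mul_assoc]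
    rw [h]
    exact idem_of_le (mul_le_mul (mul_idem_le a (hB b hb d hd).2) le_rfl) (hA a ha c hc).2

theorem mul_inv_mul_mem {A : Set S} (hl : IsLowerSet A) (hc : IsCompatible A) {a b c : S}
    (ha : a ∈ A) (hb : b ∈ A) (hc' : c ∈ A) : a * b⁻¹ * c ∈ A :=
  hl (idem_mul_le c (hc a ha b hb).2) hc'

variable (S) in
/-- The tightly closed compatible order ideals. -/
@[ext] structure TightIdeal where
  carrier : Set S
  lower : IsLowerSet carrier
  compatible : IsCompatible carrier
  closed : IsTightClosed carrier

namespace TightIdeal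

theorem closure_eq (A : TightIdeal S) : tightClosure A.carrier = A.carrier :=
  (A.closed.tightClosure_subset subset_rfl).antisymm (subset_tightClosure _)

theorem zero_mem (A : TightIdeal S) : (0 : S) ∈ A.carrier :=
  A.closed ∅ 0 (Set.empty_subset _) isTightCover_empty

instance : Zero (TightIdeal S) :=
  ⟨{0}, fun _ b h hb => by
      rw [Set.mem_singleton_iff] at hb ⊢; subst hb; exact eq_zero_of_le h,
    fun s hs t ht => by
      rw [Set.mem_singleton_iff] at hs ht; subst hs ht
      exact ⟨by rw [mul_zero]; exact mul_zero 0, by rw [zero_mul]; exact mul_zero 0⟩,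
    fun X x hX hx => by
      by_contra h0
      obtain ⟨b, hb, z, hz0, -, hzb⟩ := hx.2.2 x le_rfl h0
      have := hX hb
      rw [Set.mem_singleton_iff] at this; subst this
      exact hz0 (eq_zero_of_le hzb)⟩

/-- The inverse is the set of inverses. -/
instance : Inv (TightIdeal S) :=
  ⟨fun A => ⟨{a | a⁻¹ ∈ A.carrier}, fun _ _ h ha => A.lower (inv_le_inv h) ha,
    fun s hs t ht => by
      have := A.compatible _ hs _ ht
      rw [Compatible, inv_inv, inv_inv] at this
      exact ⟨this.2, this.1⟩,
    fun X x hX hx => A.closed _ _ (by rintro _ ⟨y, hy, rfl⟩; exact hX hy) hx.inv⟩⟩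

theorem carrier_zero : (0 : TightIdeal S).carrier = {0} := rfl

theorem mem_inv {A : TightIdeal S} {a : S} : a ∈ (A⁻¹).carrier ↔ a⁻¹ ∈ A.carrier := Iff.rfl

theorem inv_inv' (A : TightIdeal S) : A⁻¹⁻¹ = A := by
  ext a
  rw [mem_inv, mem_inv, inv_inv]

variable [TightSeparative S]

/-- The tightly closed compatible order ideal generated by a compatible order ideal. -/
def ofIdeal (A : Set S) (hl : IsLowerSet A) (hc : IsCompatible A) : TightIdeal S :=
  ⟨tightClosure A, isLowerSet_tightClosure hl, isCompatible_tightClosure hc,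
    isTightClosed_tightClosure A⟩

/-- The product is the closure of the product of subsets. -/
instance : Mul (TightIdeal S) :=
  ⟨fun A B => ofIdeal (A.carrier * B.carrier) (isLowerSet_mul B.lower)
    (isCompatible_mul A.compatible B.compatible)⟩

theorem carrier_mul (A B : TightIdeal S) :
    (A * B).carrier = tightClosure (A.carrier * B.carrier) := rfl

instance : SemigroupWithZero (TightIdeal S) where
  mul_assoc A B C := by
    ext1
    rw [carrier_mul, carrier_mul, carrier_mul, carrier_mul, tightClosure_mul_left,
      tightClosure_mul_right, mul_assoc]
  zero_mul A := by
    ext1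
    refine Set.Subset.antisymm ((0 : TightIdeal S).closed.tightClosure_subset ?_) ?_
    · rintro _ ⟨_, rfl, b, hb, rfl⟩
      exact zero_mul b
    · rintro _ rfl
      exact zero_mem _
  mul_zero A := by
    ext1
    refine Set.Subset.antisymm ((0 : TightIdeal S).closed.tightClosure_subset ?_) ?_
    · rintro _ ⟨b, hb, _, rfl, rfl⟩
      exact mul_zero b
    · rintro _ rfl
      exact zero_mem _

theorem mul_inv_mul' (A : TightIdeal S) : A * A⁻¹ * A = A := by
  ext1
  rw [carrier_mul, carrier_mul, tightClosure_mul_left]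
  refine Set.Subset.antisymm (A.closed.tightClosure_subset ?_) ?_
  · rintro _ ⟨_, ⟨a, ha, b, hb, rfl⟩, c, hc, rfl⟩
    have := mul_inv_mul_mem A.lower A.compatible ha (mem_inv.1 hb) hc
    rwa [inv_inv] at this
  · refine subset_trans ?_ (subset_tightClosure _)
    intro a ha
    exact ⟨a * a⁻¹, ⟨a, ha, a⁻¹, mem_inv.2 (by rwa [inv_inv]), rfl⟩, a, ha, mul_inv_mul a⟩

theorem isIdempotentElem_iff {A : TightIdeal S} :
    IsIdempotentElem A ↔ ∀ a ∈ A.carrier, IsIdempotentElem a := by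
  constructor
  · intro h a ha
    have h' : tightClosure (A.carrier * A.carrier) = A.carrier := congrArg carrier h
    rw [← h'] at ha
    refine isIdempotentElem_of_mem_tightClosure ?_ ha
    rintro _ ⟨e, he, f, hf, rfl⟩
    have hef : e * f ∈ A.carrier := h' ▸ subset_tightClosure _ ⟨e, he, f, hf, rfl⟩
    -- the idempotents `i = e r(f)` and `j = d(e) f` satisfy `e f = i j`
    have hi : IsIdempotentElem (e * (f * f⁻¹)) := by
      rw [← mul_assoc]; exact (A.compatible _ hef _ hf).2
    have hj : IsIdempotentElem (e⁻¹ * e * f) := by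
      rw [mul_assoc]; exact (A.compatible _ he _ hef).1
    have : e * f = e * (f * f⁻¹) * (e⁻¹ * e * f) := by
      calc e * f = (e * e⁻¹ * e) * (f * f⁻¹ * f) := by rw [mul_inv_mul, mul_inv_mul]
        _ = e * ((e⁻¹ * e) * (f * f⁻¹)) * f := by simp only [mul_assoc]
        _ = e * (f * f⁻¹) * (e⁻¹ * e * f) := by
          rw [idem_comm (idem_inv_mul e) (idem_mul_inv f)]; simp only [mul_assoc]
    show IsIdempotentElem (e * f)
    rw [this]
    exact idem_mul hi hj
  · intro h
    change A * A = A
    ext1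
    refine Set.Subset.antisymm (A.closed.tightClosure_subset ?_) ?_
    · rintro _ ⟨e, he, f, hf, rfl⟩
      exact A.lower (mul_idem_le e (h f hf)) he
    · intro e he
      exact subset_tightClosure _ ⟨e, he, e, he, h e he⟩

theorem idem_mul_comm {A B : TightIdeal S} (hA : IsIdempotentElem A) (hB : IsIdempotentElem B) :
    A * B = B * A := by
  ext1
  rw [carrier_mul, carrier_mul]
  congr 1
  rw [isIdempotentElem_iff] at hA hB
  ext x
  constructor
  · rintro ⟨a, ha, b, hb, rfl⟩
    exact ⟨b, hb, a, ha, idem_comm (hB b hb) (hA a ha)⟩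
  · rintro ⟨a, ha, b, hb, rfl⟩
    exact ⟨b, hb, a, ha, idem_comm (hA b hb) (hB a ha)⟩

instance : InverseSemigroupWithZero (TightIdeal S) where
  mul_inv_mul := mul_inv_mul'
  inv_mul_inv A := by
    have := mul_inv_mul' A⁻¹
    rwa [inv_inv'] at this
  eq_inv_of_mul A B h1 h2 := by
    have := mul_inv_mul' A⁻¹
    rw [inv_inv'] at this
    exact eq_of_idem_comm (fun _ _ => idem_mul_comm) h1 h2 (mul_inv_mul' A) this

/-- The natural partial order is inclusion. -/
theorem le_iff_subset {A B : TightIdeal S} : A ≤ B ↔ A.carrier ⊆ B.carrier := by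
  constructor
  · rintro ⟨E, hE, rfl⟩
    refine B.closed.tightClosure_subset ?_
    rintro _ ⟨b, hb, e, he, rfl⟩
    exact B.lower (mul_idem_le b (isIdempotentElem_iff.1 hE e he)) hb
  · intro h
    rw [le_iff]
    ext1
    rw [carrier_mul, carrier_mul, tightClosure_mul_right, ← mul_assoc]
    refine Set.Subset.antisymm ?_ (A.closed.tightClosure_subset ?_)
    · refine subset_trans ?_ (subset_tightClosure _)
      intro a ha
      exact ⟨a * a⁻¹, ⟨a, h ha, a⁻¹, mem_inv.2 (by rwa [inv_inv]), rfl⟩, a, ha, mul_inv_mul a⟩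
    · rintro _ ⟨_, ⟨b, hb, c, hc, rfl⟩, a, ha, rfl⟩
      have := (B.compatible b hb _ (h (mem_inv.1 hc))).2
      rw [inv_inv] at this
      exact A.lower (idem_mul_le a this) ha

/-- Compatible elements have a join, the closure of their union. -/
theorem exists_isLUB {X : Set (TightIdeal S)} (hX : IsCompatible X) :
    ∃ J, IsLUB X J ∧ J.carrier = tightClosure (⋃ A ∈ X, A.carrier) := by
  refine ⟨ofIdeal (⋃ A ∈ X, A.carrier) (isLowerSet_iUnion₂ fun A _ => A.lower) ?_, ⟨?_, ?_⟩, rfl⟩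
  · intro a ha b hb
    simp only [Set.mem_iUnion] at ha hb
    obtain ⟨A, hA, ha⟩ := ha
    obtain ⟨B, hB, hb⟩ := hb
    obtain ⟨h1, h2⟩ := hX A hA B hB
    rw [isIdempotentElem_iff] at h1 h2
    exact ⟨h1 _ (subset_tightClosure _ ⟨a⁻¹, mem_inv.2 (by rwa [inv_inv]), b, hb, rfl⟩),
      h2 _ (subset_tightClosure _ ⟨a, ha, b⁻¹, mem_inv.2 (by rwa [inv_inv]), rfl⟩)⟩
  · intro A hA
    exact le_iff_subset.2 ((Set.subset_biUnion_of_mem hA).trans (subset_tightClosure _))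
  · intro B hB
    exact le_iff_subset.2 (B.closed.tightClosure_subset
      (Set.iUnion₂_subset fun A hA => le_iff_subset.1 (hB hA)))

end TightIdeal

/-- A finite element: whenever it lies below the join of a compatible set, it lies below the join of
some finite subset. -/
def IsFiniteElement (a : S) : Prop :=
  ∀ X : Set S, IsCompatible X → ∀ j, IsLUB X j → a ≤ j →
    ∃ Y ⊆ X, Y.Finite ∧ ∃ k, IsLUB Y k ∧ a ≤ k

namespace TightIdeal

variable [TightSeparative S]

/-- The finite elements are the finitely generated ones. -/
theorem isFiniteElement_iff {A : TightIdeal S} :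
    IsFiniteElement A ↔
      ∃ G ⊆ A.carrier, G.Finite ∧ A.carrier = tightClosure (lowerClosure G : Set S) := by
  constructor
  · intro h
    let ι : S → TightIdeal S := fun a => ofIdeal (Set.Iic a) (isLowerSet_Iic a) (isCompatible_Iic a)
    have hι : ∀ a ∈ A.carrier, ι a ≤ A := fun a ha =>
      le_iff_subset.2 (A.closed.tightClosure_subset fun b hb => A.lower hb ha)
    have hmem : ∀ a, a ∈ (ι a).carrier := fun a => subset_tightClosure _ (Set.mem_Iic.2 le_rfl)
    obtain ⟨Y, hY, hYf, K, hK, hAK⟩ := h (ι '' A.carrier)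
      (by
        refine (isCompatible_Iic A).mono ?_
        rintro _ ⟨a, ha, rfl⟩
        exact hι a ha) A
      ⟨by rintro _ ⟨a, ha, rfl⟩; exact hι a ha,
        fun B hB => le_iff_subset.2 fun a ha =>
          le_iff_subset.1 (hB (Set.mem_image_of_mem ι ha)) (hmem a)⟩ le_rfl
    obtain ⟨G, hGA, hGf, rfl⟩ :=
      Set.exists_subset_image_finite_and.1 ⟨Y, hY, hYf, (rfl : Y = Y)⟩
    have hGl : (lowerClosure G : Set S) ⊆ A.carrier := by
      rintro x ⟨g, hg, hxg⟩
      exact A.lower hxg (hGA hg)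
    refine ⟨G, hGA, hGf, Set.Subset.antisymm ?_ (A.closed.tightClosure_subset hGl)⟩
    have hB : K ≤ ofIdeal (lowerClosure G : Set S) (lowerClosure G).lower
        (A.compatible.mono hGl) := by
      refine hK.2 ?_
      rintro _ ⟨g, hg, rfl⟩
      exact le_iff_subset.2 (tightClosure_mono fun b hb => ⟨g, hg, hb⟩)
    exact (le_iff_subset.1 hAK).trans (le_iff_subset.1 hB)
  · rintro ⟨G, hGA, hGf, hA⟩ X hX J hJ hAJ
    obtain ⟨J', hJ', hJc⟩ := exists_isLUB hX
    obtain rfl := hJ.unique hJ'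
    have h1 : ∀ g : S, ∃ Y : Set (TightIdeal S), Y ⊆ X ∧ Y.Finite ∧
        (g ∈ G → g ∈ tightClosure (⋃ B ∈ Y, B.carrier)) := by
      intro g
      by_cases hg : g ∈ G
      · have hgJ := le_iff_subset.1 hAJ (hGA hg)
        rw [hJc] at hgJ
        obtain ⟨Z, hZ, hZg⟩ := hgJ
        have h2 : ∀ z : S, ∃ B : TightIdeal S, z ∈ Z → B ∈ X ∧ z ∈ B.carrier := by
          intro z
          by_cases hz : z ∈ Z
          · have := hZ hz
            simp only [Set.mem_iUnion] at this
            obtain ⟨B, hB, hzB⟩ := this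
            exact ⟨B, fun _ => ⟨hB, hzB⟩⟩
          · exact ⟨0, fun h => absurd h hz⟩
        choose B hB using h2
        refine ⟨B '' Z, ?_, hZg.1.image B, fun _ => ⟨Z, ?_, hZg⟩⟩
        · rintro _ ⟨z, hz, rfl⟩
          exact (hB z hz).1
        · intro z hz
          exact Set.mem_biUnion (Set.mem_image_of_mem B hz) (hB z hz).2
      · exact ⟨∅, Set.empty_subset _, Set.finite_empty, fun h => absurd h hg⟩
    choose Y hYX hYf hY using h1
    have hsub : (⋃ g ∈ G, Y g) ⊆ X := Set.iUnion₂_subset fun g _ => hYX g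
    obtain ⟨K, hK, hKc⟩ := exists_isLUB (hX.mono hsub)
    refine ⟨_, hsub, hGf.biUnion fun g _ => hYf g, K, hK, le_iff_subset.2 ?_⟩
    rw [hA]
    refine K.closed.tightClosure_subset ?_
    rintro x ⟨g, hg, hxg⟩
    refine K.lower hxg ?_
    rw [hKc]
    exact tightClosure_mono (Set.biUnion_subset_biUnion_left (Set.subset_biUnion_of_mem hg)) (hY g hg)

theorem isFiniteElement_zero : IsFiniteElement (0 : TightIdeal S) := by
  refine isFiniteElement_iff.2 ⟨∅, Set.empty_subset _, Set.finite_empty, ?_⟩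
  refine Set.Subset.antisymm ?_ ((0 : TightIdeal S).closed.tightClosure_subset ?_)
  · rintro _ rfl
    exact ⟨∅, Set.empty_subset _, isTightCover_empty⟩
  · simp

theorem isFiniteElement_mul {A B : TightIdeal S} (hA : IsFiniteElement A)
    (hB : IsFiniteElement B) : IsFiniteElement (A * B) := by
  obtain ⟨G, hGA, hGf, hG⟩ := isFiniteElement_iff.1 hA
  obtain ⟨H, hHB, hHf, hH⟩ := isFiniteElement_iff.1 hB
  refine isFiniteElement_iff.2 ⟨G * H, (Set.mul_subset_mul hGA hHB).trans (subset_tightClosure _),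
    hGf.mul hHf, ?_⟩
  rw [carrier_mul, hG, hH, tightClosure_mul_left, tightClosure_mul_right]
  congr 1
  ext x
  constructor
  · rintro ⟨a, ⟨g, hg, hag⟩, b, ⟨h, hh, hbh⟩, rfl⟩
    exact ⟨g * h, ⟨g, hg, h, hh, rfl⟩, mul_le_mul hag hbh⟩
  · rintro ⟨_, ⟨g, hg, h, hh, rfl⟩, ⟨e, he, rfl⟩⟩
    exact ⟨g, ⟨g, hg, le_rfl⟩, h * e, ⟨h, hh, mul_idem_le h he⟩, (mul_assoc g h e).symm⟩

theorem isFiniteElement_inv {A : TightIdeal S} (hA : IsFiniteElement A) :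
    IsFiniteElement A⁻¹ := by
  obtain ⟨G, hGA, hGf, hG⟩ := isFiniteElement_iff.1 hA
  refine isFiniteElement_iff.2 ⟨(fun x => x⁻¹) '' G, ?_, hGf.image _, ?_⟩
  · rintro _ ⟨g, hg, rfl⟩
    exact mem_inv.2 (by rw [inv_inv]; exact hGA hg)
  · refine Set.Subset.antisymm ?_ ((A⁻¹).closed.tightClosure_subset ?_)
    · intro a ha
      rw [mem_inv, hG] at ha
      obtain ⟨X, hX, ha⟩ := ha
      have := ha.inv
      rw [inv_inv] at this
      refine ⟨_, ?_, this⟩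
      rintro _ ⟨x, hx, rfl⟩
      obtain ⟨g, hg, hxg⟩ := hX hx
      exact ⟨g⁻¹, ⟨g, hg, rfl⟩, inv_le_inv hxg⟩
    · rintro x ⟨_, ⟨g, hg, rfl⟩, hxg⟩
      exact (A⁻¹).lower hxg (mem_inv.2 (by rw [inv_inv]; exact hGA hg))

end TightIdeal

variable (S) in
/-- The tight completion of `S`: the finite elements of the pseudogroup of tightly closed compatible
order ideals of the separative quotient of `S`. -/
def TightCompletion : Type _ := {A : TightIdeal (TightQuotient S) // IsFiniteElement A}

instance : InverseSemigroupWithZero (TightCompletion S) where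
  mul A B := ⟨A.1 * B.1, TightIdeal.isFiniteElement_mul A.2 B.2⟩
  mul_assoc A B C := Subtype.ext (mul_assoc A.1 B.1 C.1)
  zero := ⟨0, TightIdeal.isFiniteElement_zero⟩
  zero_mul A := Subtype.ext (zero_mul A.1)
  mul_zero A := Subtype.ext (mul_zero A.1)
  inv A := ⟨A.1⁻¹, TightIdeal.isFiniteElement_inv A.2⟩
  mul_inv_mul A := Subtype.ext (mul_inv_mul A.1)
  inv_mul_inv A := Subtype.ext (inv_mul_inv A.1)
  eq_inv_of_mul _ _ h1 h2 :=
    Subtype.ext (eq_inv (congrArg Subtype.val h1) (congrArg Subtype.val h2))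

end Basic

section Notions

variable (S : Type*) [InverseSemigroupWithZero S]

/-- The weak meet condition: the intersection of any two principal order ideals is finitely
generated as an order ideal. -/
def WeakMeetCondition : Prop :=
  ∀ a b : S, ∃ C : Set S, C.Finite ∧ Set.Iic a ∩ Set.Iic b = (lowerClosure C : Set S)

/-- A distributive inverse semigroup: finite compatible subsets have joins, and multiplication
distributes over the finite joins that exist. -/
structure IsDistributive : Prop where
  exists_isLUB : ∀ X : Set S, X.Finite → IsCompatible X → ∃ j, IsLUB X j
  mul_isLUB : ∀ X : Set S, X.Finite → ∀ j, IsLUB X j → ∀ s, IsLUB ((fun x => s * x) '' X) (s * j)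
  isLUB_mul : ∀ X : Set S, X.Finite → ∀ j, IsLUB X j → ∀ s, IsLUB ((fun x => x * s) '' X) (j * s)

/-- A weakly boolean inverse semigroup: it is distributive and its idempotents form a generalized
boolean algebra under the natural partial order. -/
def IsWeaklyBoolean : Prop :=
  IsDistributive S ∧ ∃ B : GeneralizedBooleanAlgebra {e : S // IsIdempotentElem e},
    ∀ e f : {e : S // IsIdempotentElem e}, B.le e f ↔ (e : S) ≤ f

/-- A boolean inverse semigroup: it is weakly boolean and has all binary meets. -/
def IsBoolean : Prop := IsWeaklyBoolean S ∧ ∀ a b : S, ∃ c, IsGLB {a, b} c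

/-- The set of all proper filters of `S`. -/
def ProperFilter : Type _ := {F : Order.PFilter S // (0 : S) ∉ F}

variable {S}

instance : Membership S (ProperFilter S) := ⟨fun F s => s ∈ F.1⟩

/-- The set of all proper filters that contain `x` and omit all elements of `X`. -/
def patchBasic (x : S) (X : Set S) : Set (ProperFilter S) := {F | x ∈ F ∧ ∀ y ∈ X, y ∉ F}

/-- The patch topology. -/
instance : TopologicalSpace (ProperFilter S) :=
  .generateFrom {U | ∃ (x : S) (X : Set S), X.Finite ∧ (∀ y ∈ X, y ≤ x) ∧ U = patchBasic x X}

/-- An ultrafilter is a maximal proper filter. -/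
def ProperFilter.IsUltra (F : ProperFilter S) : Prop :=
  Maximal (fun G : Order.PFilter S => (0 : S) ∉ G) F.1

variable (S) in
/-- The space of ultrafilters, with the topology induced by the patch topology. -/
abbrev UltrafilterSpace : Type _ := {F : ProperFilter S // F.IsUltra}

/-- The set of all ultrafilters that contain `x` and omit all elements of `X`. -/
def ultraBasic (x : S) (X : Set S) : Set (UltrafilterSpace S) := {F | F.1 ∈ patchBasic x X}

variable (S) in
/-- The compactness condition: the ultrafilters form a closed subset of the space of all proper
filters with the patch topology. -/
def CompactnessCondition : Prop := IsClosed {F : ProperFilter S | F.IsUltra}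

end Notions

end InvSem

namespace InvSem

/-! ### Ultrafilters, disjointness and tight coverings -/

section Filters

variable {S : Type*} [InverseSemigroupWithZero S]

/-! Everything is read off from two facts about ultrafilters. First, a proper filter `F` is an
ultrafilter exactly when every `s ≤ x ∈ F` outside `F` is disjoint from some `t ∈ F`, that is, has
no nonzero lower bound in common with it (`IsUltra.exists_disjoint`, `isUltra_of_exists_disjoint`).
Second, every nonzero element lies in an ultrafilter, so a finite `X` below `x` is a tight covering
of `x` iff every ultrafilter through `x` meets `X`. Hence the pivot `ultraBasic_eq_iUnion_iff`: for
idempotents, `V_{e;X} = ⋃ V_g` over `g ∈ Y` says that `X ∪ Y` tightly covers `e` and `Y` is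
orthogonal to `X`, so that `Y` is a complement of `X` in `e` up to tight coverings.

The weak meet condition makes each `U_x` compact. If the ultrafilters are closed, every `V_x` is
therefore compact, and so is its closed subset `V_{x;X}`. Each ultrafilter in `V_{e;X}` contains
some `t ≤ e` disjoint from all of `X`, and compactness leaves finitely many such `t`. Conversely,
let `F` be a limit of ultrafilters and `s ≤ x ∈ F` with `s ∉ F`. Complement `s⁻¹ * s` in `x⁻¹ * x`
and translate by `x`: this covers `x` by `s` and finitely many elements disjoint from `s`. Nearby
ultrafilters meet this covering, hence so does `F`, and `F` is an ultrafilter.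

The tight completion is always distributive, and the weak meet condition gives it meets, so being
boolean reduces to relative complements of idempotents. Its idempotents are generated by finitely
many classes of idempotents of `S`; complements therefore translate into the covering data above, in
both directions. -/

theorem le_mul_idem_of_le {z s t : S} (hs : z ≤ s) (ht : z ≤ t) : z ≤ s * (t⁻¹ * t) := by
  rw [le_iff.1 hs]
  exact mul_le_mul le_rfl (mul_le_mul (inv_le_inv ht) ht)

/-- Both sides are `x` cut down to the product of the domains of `s` and `t`. With
`le_mul_idem_of_le` this makes `s * (t⁻¹ * t)` the meet of two elements that have a common upper
bound. -/
theorem mul_idem_eq_of_le {s t x : S} (hs : s ≤ x) (ht : t ≤ x) :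
    s * (t⁻¹ * t) = t * (s⁻¹ * s) := by
  have h1 := le_iff.1 hs
  have h2 := le_iff.1 ht
  calc s * (t⁻¹ * t) = x * ((s⁻¹ * s) * (t⁻¹ * t)) := by rw [← mul_assoc x, ← h1]
    _ = x * (t⁻¹ * t) * (s⁻¹ * s) := by
      rw [idem_comm (idem_inv_mul s) (idem_inv_mul t), ← mul_assoc x]
    _ = t * (s⁻¹ * s) := by rw [← h2]

theorem mul_idem_le_of_le {s t x : S} (hs : s ≤ x) (ht : t ≤ x) : s * (t⁻¹ * t) ≤ t := by
  rw [mul_idem_eq_of_le hs ht]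
  exact mul_idem_le _ (idem_inv_mul s)

theorem le_mul_of_idem {z e f : S} (hf : IsIdempotentElem f)
    (h1 : z ≤ e) (h2 : z ≤ f) : z ≤ e * f := by
  have := le_mul_idem_of_le h1 h2
  rwa [idem_inv hf, hf.eq] at this

namespace ProperFilter

theorem mem_of_le {F : ProperFilter S} {a b : S} (h : a ≤ b) (ha : a ∈ F) : b ∈ F :=
  F.1.mem_of_le h ha

theorem zero_notMem (F : ProperFilter S) : (0 : S) ∉ F := F.2

theorem ne_zero_of_mem {F : ProperFilter S} {a : S} (ha : a ∈ F) : a ≠ 0 := by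
  rintro rfl
  exact F.zero_notMem ha

theorem exists_mem (F : ProperFilter S) : ∃ a, a ∈ F := F.1.nonempty

theorem exists_mem_le {F : ProperFilter S} {a b : S} (ha : a ∈ F) (hb : b ∈ F) :
    ∃ c ∈ F, c ≤ a ∧ c ≤ b := F.1.directed a ha b hb

/-- The proper filter with a given set of members. -/
def ofSet (A : Set S) (h0 : (0 : S) ∉ A) (hn : A.Nonempty) (hd : DirectedOn (· ≥ ·) A)
    (hu : ∀ {a b : S}, a ≤ b → a ∈ A → b ∈ A) : ProperFilter S :=
  ⟨(Order.IsPFilter.of_def hn hd hu).toPFilter, h0⟩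

theorem isUltra_iff_forall {F : ProperFilter S} :
    F.IsUltra ↔ ∀ G : ProperFilter S, (∀ a ∈ F, a ∈ G) → ∀ a ∈ G, a ∈ F :=
  ⟨fun h G hG _ ha => h.2 (y := G.1) G.2 hG ha, fun h => ⟨F.2, fun G hG hFG => h ⟨G, hG⟩ hFG⟩⟩

/-- Finitely many members of a filter have a lower bound in the filter. -/
theorem exists_mem_forall_le (F : ProperFilter S) {x : S} (hx : x ∈ F) {X : Set S}
    (hX : X.Finite) (P : S → S → Prop) (hP : ∀ y ∈ X, ∃ t ∈ F, P y t)
    (hmono : ∀ y t u, u ≤ t → P y t → P y u) : ∃ t ∈ F, t ≤ x ∧ ∀ y ∈ X, P y t := by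
  induction X, hX using Set.Finite.induction_on with
  | empty => exact ⟨x, hx, le_rfl, by simp⟩
  | @insert a X _ _ ih =>
    obtain ⟨t, ht, htx, h⟩ := ih fun y hy => hP y (Set.mem_insert_of_mem _ hy)
    obtain ⟨u, hu, hau⟩ := hP a (Set.mem_insert _ _)
    obtain ⟨v, hv, hvt, hvu⟩ := exists_mem_le ht hu
    refine ⟨v, hv, hvt.trans htx, ?_⟩
    rintro y (rfl | hy)
    · exact hmono _ _ _ hvu hau
    · exact hmono _ _ _ hvt (h y hy)

/-- Every element below a member of an ultrafilter either belongs to the ultrafilter or is disjoint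
from some member. -/
theorem IsUltra.exists_disjoint {F : ProperFilter S} (hF : F.IsUltra) {x s : S} (hx : x ∈ F)
    (hs : s ≤ x) (hsF : s ∉ F) : ∃ t ∈ F, ∀ z ≤ s, z ≤ t → z = 0 := by
  by_contra! hcon
  -- If `s` meets every member of `F`, then the meets of `s` with the members `t ≤ x` generate a
  -- proper filter that contains `F` and `s`, so maximality forces `s ∈ F`.
  refine hsF (isUltra_iff_forall.1 hF
    (ofSet {y | ∃ t ∈ F, t ≤ x ∧ s * (t⁻¹ * t) ≤ y} ?_ ?_ ?_ ?_) ?_ s ?_)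
  · rintro ⟨t, ht, htx, h⟩
    obtain ⟨z, hz, hzt, h0⟩ := hcon t ht
    exact h0 (eq_zero_of_le ((le_mul_idem_of_le hz hzt).trans h))
  · exact ⟨_, x, hx, le_rfl, le_rfl⟩
  · rintro a ⟨t, ht, htx, hta⟩ b ⟨u, hu, hux, hub⟩
    obtain ⟨v, hv, hvt, hvu⟩ := exists_mem_le ht hu
    refine ⟨s * (v⁻¹ * v), ⟨v, hv, hvt.trans htx, le_rfl⟩, ?_, ?_⟩
    · exact (mul_le_mul le_rfl (mul_le_mul (inv_le_inv hvt) hvt)).trans hta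
    · exact (mul_le_mul le_rfl (mul_le_mul (inv_le_inv hvu) hvu)).trans hub
  · rintro a b hab ⟨t, ht, htx, hta⟩
    exact ⟨t, ht, htx, hta.trans hab⟩
  · intro a ha
    obtain ⟨t, ht, hta, htx⟩ := exists_mem_le ha hx
    exact ⟨t, ht, htx, (mul_idem_le_of_le hs htx).trans hta⟩
  · exact ⟨x, hx, le_rfl, mul_idem_le _ (idem_inv_mul x)⟩

/-- A larger proper filter would contain some `s ≤ x` outside `F` together with the `t ∈ F` disjoint
from it, and these have a nonzero lower bound in that filter. -/
theorem isUltra_of_exists_disjoint {F : ProperFilter S}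
    (h : ∀ x ∈ F, ∀ s ≤ x, s ∉ F → ∃ t ∈ F, ∀ z ≤ s, z ≤ t → z = 0) : F.IsUltra := by
  refine isUltra_iff_forall.2 fun G hG a ha => ?_
  by_contra haF
  obtain ⟨x, hx⟩ := F.exists_mem
  obtain ⟨s, hs, hsa, hsx⟩ := exists_mem_le ha (hG x hx)
  obtain ⟨t, ht, hst⟩ := h x hx s hsx fun hsF => haF (mem_of_le hsa hsF)
  obtain ⟨z, hz, hzs, hzt⟩ := exists_mem_le hs (hG t ht)
  exact ne_zero_of_mem hz (hst z hzs hzt)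

/-- Every nonzero element belongs to an ultrafilter. -/
theorem exists_isUltra_mem {a : S} (ha : a ≠ 0) : ∃ F : ProperFilter S, F.IsUltra ∧ a ∈ F := by
  have h0 : (0 : S) ∉ Order.PFilter.principal a := fun h =>
    ha (eq_zero_of_le (Order.PFilter.mem_principal.1 h))
  obtain ⟨M, haM, hM⟩ := zorn_le_nonempty₀ {G : Order.PFilter S | (0 : S) ∉ G} (by
    intro c hc hch G hG
    refine ⟨(Order.IsPFilter.of_def (F := ⋃ H ∈ c, (H : Set S)) ?_ ?_ ?_).toPFilter, ?_, ?_⟩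
    · obtain ⟨x, hx⟩ := G.nonempty
      exact ⟨x, Set.mem_biUnion hG hx⟩
    · intro x hx y hy
      simp only [Set.mem_iUnion] at hx hy
      obtain ⟨H, hH, hx⟩ := hx
      obtain ⟨K, hK, hy⟩ := hy
      rcases hch.total hH hK with h | h
      · obtain ⟨z, hz, h1⟩ := K.directed x (h hx) y hy
        exact ⟨z, Set.mem_biUnion hK hz, h1⟩
      · obtain ⟨z, hz, h1⟩ := H.directed x hx y (h hy)
        exact ⟨z, Set.mem_biUnion hH hz, h1⟩
    · intro x y hxy hx
      simp only [Set.mem_iUnion] at hx ⊢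
      obtain ⟨H, hH, hx⟩ := hx
      exact ⟨H, hH, H.mem_of_le hxy hx⟩
    · intro h
      obtain ⟨H, hH, h⟩ := Set.mem_iUnion₂.1 (show (0 : S) ∈ ⋃ H ∈ c, (H : Set S) from h)
      exact hc hH h
    · exact fun H hH x hx => Set.mem_biUnion hH hx) _ h0
  exact ⟨⟨M, hM.1⟩, hM, haM (Order.PFilter.mem_principal.2 le_rfl)⟩

/-- Ultrafilters are tight. -/
theorem IsUltra.exists_mem_of_isTightCover {F : ProperFilter S} (hF : F.IsUltra) {x : S}
    (hx : x ∈ F) {X : Set S} (hX : IsTightCover X x) : ∃ y ∈ X, y ∈ F := by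
  by_contra! hcon
  -- Each of the finitely many members of `X` is disjoint from a member of `F`; a common lower bound
  -- `t` is disjoint from all of them, which contradicts the covering.
  obtain ⟨t, ht, htx, h⟩ := F.exists_mem_forall_le hx hX.1 (fun y t => ∀ z ≤ y, z ≤ t → z = 0)
    (fun y hy => hF.exists_disjoint hx (hX.2.1 hy) (hcon y hy))
    fun y t u hut h z hzy hzu => h z hzy (hzu.trans hut)
  obtain ⟨y, hy, z, hz0, hzt, hzy⟩ := hX.2.2 t htx (ne_zero_of_mem ht)
  exact hz0 (h y hy z hzy hzt)

/-- An ultrafilter through a nonzero `z ≤ x` contains some `y ∈ X`, hence a nonzero lower bound of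
`z` and `y`. This is the converse of `IsUltra.exists_mem_of_isTightCover`. -/
theorem isTightCover_of_forall_ultra {x : S} {X : Set S} (hXf : X.Finite) (hX : X ⊆ Set.Iic x)
    (h : ∀ F : ProperFilter S, F.IsUltra → x ∈ F → ∃ y ∈ X, y ∈ F) : IsTightCover X x := by
  refine ⟨hXf, hX, fun z hz h0 => ?_⟩
  obtain ⟨F, hF, hzF⟩ := exists_isUltra_mem h0
  obtain ⟨y, hy, hyF⟩ := h F hF (mem_of_le hz hzF)
  obtain ⟨u, hu, huz, huy⟩ := exists_mem_le hzF hyF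
  exact ⟨y, hy, u, ne_zero_of_mem hu, huz, huy⟩

end ProperFilter

/-! ### Compactness in the patch topology and decompositions of basic sets -/

open ProperFilter

theorem isOpen_patchBasic {x : S} {X : Set S} (hX : X.Finite) (h : ∀ y ∈ X, y ≤ x) :
    IsOpen (patchBasic x X) := TopologicalSpace.isOpen_generateFrom_of_mem ⟨x, X, hX, h, rfl⟩

theorem isOpen_patchBasic_empty (x : S) : IsOpen (patchBasic x (∅ : Set S)) :=
  isOpen_patchBasic Set.finite_empty (by simp)

theorem mem_patchBasic_empty {x : S} {F : ProperFilter S} : F ∈ patchBasic x ∅ ↔ x ∈ F := by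
  simp [patchBasic]

theorem mem_ultraBasic_empty {x : S} {F : UltrafilterSpace S} :
    F ∈ ultraBasic x ∅ ↔ x ∈ F.1 := mem_patchBasic_empty

/-- The form in which the weak meet condition enters the topology: `U_a ∩ U_b` is a finite union of
sets `U_c`. -/
theorem WeakMeetCondition.exists_mem_iff (hS : WeakMeetCondition S) (a b : S) :
    ∃ C : Set S, C.Finite ∧ (∀ c ∈ C, c ≤ a ∧ c ≤ b) ∧
      ∀ F : ProperFilter S, a ∈ F → b ∈ F → ∃ c ∈ C, c ∈ F := by
  obtain ⟨C, hC, h⟩ := hS a b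
  refine ⟨C, hC, fun c hc => ?_, fun F ha hb => ?_⟩
  · have : c ∈ Set.Iic a ∩ Set.Iic b := h ▸ subset_lowerClosure hc
    exact this
  · obtain ⟨z, hz, hza, hzb⟩ := exists_mem_le ha hb
    obtain ⟨c, hc, hzc⟩ : z ∈ (lowerClosure C : Set S) := h ▸ ⟨hza, hzb⟩
    exact ⟨c, hc, mem_of_le hzc hz⟩

/-- Under the weak meet condition the filters containing `x` form a compact set. -/
theorem isCompact_patchBasic_empty (hS : WeakMeetCondition S) (x : S) :
    IsCompact (patchBasic x (∅ : Set S)) := by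
  rw [isCompact_iff_ultrafilter_le_nhds]
  intro 𝒰 h𝒰
  have hx : patchBasic x ∅ ∈ 𝒰 := Filter.le_principal_iff.1 h𝒰
  -- The only candidate for the limit: `y` belongs to it iff `𝒰` contains `U_y`.
  refine ⟨ofSet {y | patchBasic y ∅ ∈ 𝒰} ?_ ⟨x, hx⟩ ?_ ?_, mem_patchBasic_empty.2 hx, ?_⟩
  · intro h
    obtain ⟨F, hF⟩ := 𝒰.nonempty_of_mem h
    exact F.zero_notMem (mem_patchBasic_empty.1 hF)
  · intro a ha b hb
    obtain ⟨C, hC, hCl, h⟩ := hS.exists_mem_iff a b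
    have : ⋃ c ∈ C, patchBasic c ∅ ∈ 𝒰 := by
      filter_upwards [ha, hb] with F hFa hFb
      obtain ⟨c, hc, hcF⟩ := h F (mem_patchBasic_empty.1 hFa) (mem_patchBasic_empty.1 hFb)
      exact Set.mem_biUnion hc (mem_patchBasic_empty.2 hcF)
    -- Directedness: an ultrafilter of sets that contains a finite union contains one of its terms.
    obtain ⟨c, hc, hcU⟩ := (Ultrafilter.finite_biUnion_mem_iff hC).1 this
    exact ⟨c, hcU, hCl c hc⟩
  · intro a b hab ha
    refine Filter.mem_of_superset ha fun F hF => ?_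
    exact mem_patchBasic_empty.2 (mem_of_le hab (mem_patchBasic_empty.1 hF))
  · rw [TopologicalSpace.nhds_generateFrom]
    refine le_iInf₂ fun U hU => ?_
    obtain ⟨hFU, y, Y, hY, hYy, rfl⟩ := hU
    rw [Filter.le_principal_iff]
    have h1 : patchBasic y ∅ ∈ 𝒰 := hFU.1
    have h2 : ⋂ z ∈ Y, (patchBasic z ∅)ᶜ ∈ 𝒰 :=
      (Filter.biInter_mem hY).2 fun z hz => Ultrafilter.compl_mem_iff_notMem.2 (hFU.2 z hz)
    filter_upwards [h1, h2] with F hF1 hF2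
    refine ⟨mem_patchBasic_empty.1 hF1, fun z hz hzF => ?_⟩
    exact Set.mem_iInter₂.1 hF2 z hz (mem_patchBasic_empty.2 hzF)

theorem image_ultraBasic (x : S) (X : Set S) :
    Subtype.val '' ultraBasic x X = patchBasic x X ∩ {F : ProperFilter S | F.IsUltra} := by
  ext F
  constructor
  · rintro ⟨F, hF, rfl⟩
    exact ⟨hF, F.2⟩
  · rintro ⟨h, hF⟩
    exact ⟨⟨F, hF⟩, h, rfl⟩

theorem CompactnessCondition.isCompact_ultraBasic (h : CompactnessCondition S)
    (hS : WeakMeetCondition S) (x : S) : IsCompact (ultraBasic x ∅) := by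
  rw [Subtype.isCompact_iff, image_ultraBasic]
  exact (isCompact_patchBasic_empty hS x).inter_right h

/-- Removing the open sets `V_y` leaves a closed subset of `V_x`, whatever `X` is. -/
theorem isCompact_ultraBasic_of_empty {x : S} (h : IsCompact (ultraBasic x ∅)) (X : Set S) :
    IsCompact (ultraBasic x X) := by
  have : ultraBasic x X = ultraBasic x ∅ ∩ ⋂ y ∈ X, (ultraBasic y ∅)ᶜ := by
    ext F
    simp [ultraBasic, patchBasic]
  rw [this]
  refine h.inter_right (isClosed_biInter fun y _ => ?_)
  exact ((isOpen_patchBasic_empty y).preimage continuous_subtype_val).isClosed_compl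

/-- The sets `V_t`, for `t ≤ e` disjoint from all of `X`, lie in `V_{e;X}` and cover it; `Y` is a
finite subcover. Such `t` are idempotent because they lie below `e`. -/
theorem exists_ultraBasic_eq_iUnion {e : S} {X : Set S} (he : IsIdempotentElem e)
    (hX : X.Finite) (hXe : ∀ f ∈ X, f ≤ e) (hc : IsCompact (ultraBasic e X)) :
    ∃ Y : Set S, Y.Finite ∧ (∀ g ∈ Y, IsIdempotentElem g ∧ g ≤ e) ∧
      ultraBasic e X = ⋃ g ∈ Y, ultraBasic g ∅ := by
  obtain ⟨Y, hY, hYf, hcov⟩ := hc.elim_finite_subcover_image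
    (b := {t | t ≤ e ∧ ∀ f ∈ X, ∀ z ≤ f, z ≤ t → z = 0}) (c := fun t => ultraBasic t ∅)
    (fun t _ => (isOpen_patchBasic_empty t).preimage continuous_subtype_val) (by
      intro F hF
      obtain ⟨t, ht, hte, h⟩ := F.1.exists_mem_forall_le hF.1 hX
        (fun y t => ∀ z ≤ y, z ≤ t → z = 0)
        (fun f hf => F.2.exists_disjoint hF.1 (hXe f hf) (hF.2 f hf))
        fun y t u hut h z hzy hzu => h z hzy (hzu.trans hut)
      exact Set.mem_biUnion (show t ∈ {t | _} from ⟨hte, h⟩) (mem_ultraBasic_empty.2 ht))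
  refine ⟨Y, hYf, fun g hg => ⟨idem_of_le (hY hg).1 he, (hY hg).1⟩, hcov.antisymm ?_⟩
  refine Set.iUnion₂_subset fun g hg F hF => ?_
  rw [mem_ultraBasic_empty] at hF
  refine ⟨mem_of_le (hY hg).1 hF, fun f hf hfF => ?_⟩
  obtain ⟨z, hz, hzf, hzg⟩ := exists_mem_le hfF hF
  exact ne_zero_of_mem hz ((hY hg).2 f hf z hzf hzg)

/-- A decomposition of `ultraBasic e X` into basic sets of idempotents amounts to a tight covering
of `e` by `X` together with idempotents orthogonal to `X`. -/
theorem ultraBasic_eq_iUnion_iff {e : S} {X Y : Set S} (hX : X.Finite)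
    (hXe : ∀ f ∈ X, IsIdempotentElem f ∧ f ≤ e) (hY : Y.Finite)
    (hYe : ∀ g ∈ Y, IsIdempotentElem g ∧ g ≤ e) :
    ultraBasic e X = ⋃ g ∈ Y, ultraBasic g ∅ ↔
      IsTightCover (X ∪ Y) e ∧ ∀ g ∈ Y, ∀ f ∈ X, g * f = 0 := by
  constructor
  · intro h
    refine ⟨isTightCover_of_forall_ultra (hX.union hY) ?_ fun F hF heF => ?_, fun g hg f hf => ?_⟩
    · rintro y (hy | hy)
      exacts [(hXe y hy).2, (hYe y hy).2]
    · by_contra! hcon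
      have hF' : (⟨F, hF⟩ : UltrafilterSpace S) ∈ ultraBasic e X :=
        ⟨heF, fun y hy => hcon y (Or.inl hy)⟩
      rw [h] at hF'
      obtain ⟨g, hg, hgF⟩ := Set.mem_iUnion₂.1 hF'
      exact hcon g (Or.inr hg) (mem_ultraBasic_empty.1 hgF)
    -- An ultrafilter through a nonzero `g * f` would contain `g`, hence lie in `V_{e;X}`, and also
    -- contain the forbidden `f`.
    · by_contra h0
      obtain ⟨F, hF, hgf⟩ := exists_isUltra_mem h0
      have hF' : (⟨F, hF⟩ : UltrafilterSpace S) ∈ ultraBasic e X :=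
        h ▸ Set.mem_biUnion hg
          (mem_ultraBasic_empty.2 (mem_of_le (mul_idem_le g (hXe f hf).1) hgf))
      exact hF'.2 f hf (mem_of_le (idem_mul_le f (hYe g hg).1) hgf)
  · rintro ⟨h, h0⟩
    ext F
    simp only [Set.mem_iUnion, mem_ultraBasic_empty, exists_prop]
    constructor
    · intro hF
      obtain ⟨y, hy | hy, hyF⟩ := F.2.exists_mem_of_isTightCover hF.1 h
      · exact absurd hyF (hF.2 y hy)
      · exact ⟨y, hy, hyF⟩
    · rintro ⟨g, hg, hgF⟩
      refine ⟨mem_of_le (hYe g hg).2 hgF, fun f hf hfF => ?_⟩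
      obtain ⟨z, hz, hzg, hzf⟩ := exists_mem_le hgF hfF
      have := le_mul_of_idem (hXe f hf).1 hzg hzf
      rw [h0 g hg f hf] at this
      exact ne_zero_of_mem hz (eq_zero_of_le this)

/-- If every idempotent `f ≤ e` is relatively complemented up to tight coverings, then limits of
ultrafilters are ultrafilters. -/
theorem compactnessCondition_of_isTightCover
    (h : ∀ e f : S, IsIdempotentElem e → IsIdempotentElem f → f ≤ e →
      ∃ Y : Set S, IsTightCover ({f} ∪ Y) e ∧ ∀ g ∈ Y, IsIdempotentElem g ∧ g * f = 0) :
    CompactnessCondition S := by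
  refine isClosed_of_closure_subset fun F hF => isUltra_of_exists_disjoint fun x hx s hs hsF => ?_
  have hse : s⁻¹ * s ≤ x⁻¹ * x := mul_le_mul (inv_le_inv hs) hs
  obtain ⟨Y, hY, hYs⟩ := h _ _ (idem_inv_mul x) (idem_inv_mul s) hse
  -- Left multiplication by `x` turns the covering of the domain `x⁻¹ * x` into a covering of `x` by
  -- `s = x * (s⁻¹ * s)` and the elements `x * g`.
  have hcov := (isTightCover_singleton x).mul hY
  rw [← mul_assoc x x⁻¹ x, mul_inv_mul, Set.singleton_mul] at hcov
  have : ∃ g ∈ Y, x * g ∈ F := by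
    by_contra! hcon
    -- If `F` omits the whole covering, a basic neighbourhood of `F` omits it too; but that
    -- neighbourhood contains an ultrafilter through `x`, which is tight.
    obtain ⟨G, hGb, hG⟩ := mem_closure_iff.1 hF
      (patchBasic x ((fun y => x * y) '' ({s⁻¹ * s} ∪ Y))) (isOpen_patchBasic hcov.1 hcov.2.1) (by
        refine ⟨hx, ?_⟩
        rintro _ ⟨y, rfl | hy, rfl⟩
        · change x * (s⁻¹ * s) ∉ F
          rwa [← le_iff.1 hs]
        · exact hcon y hy)
    obtain ⟨y, hy, hyG⟩ := IsUltra.exists_mem_of_isTightCover hG hGb.1 hcov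
    exact hGb.2 y hy hyG
  obtain ⟨g, hg, hgF⟩ := this
  refine ⟨x * g, hgF, fun z hzs hzg => eq_zero_of_le ?_⟩
  have h1 := le_mul_idem_of_le hzg hzs
  rwa [mul_assoc, (hYs g hg).2, mul_zero] at h1

end Filters

end InvSem

namespace InvSem

/-! ### Weakly boolean inverse semigroups through relative complements -/

section Boolean

variable {R : Type*} [InverseSemigroupWithZero R]

theorem isCompatible_of_idem {A : Set R} (hA : ∀ a ∈ A, IsIdempotentElem a) : IsCompatible A := by
  intro s hs t ht
  unfold Compatible
  rw [idem_inv (hA s hs), idem_inv (hA t ht)]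
  exact ⟨idem_mul (hA s hs) (hA t ht), idem_mul (hA s hs) (hA t ht)⟩

/-- Since `j * e = e` for every idempotent `e ≤ j`, distributivity makes `j * j` another join of the
same set. -/
theorem IsDistributive.idem_of_isLUB (hR : IsDistributive R) {X : Set R} (hXf : X.Finite)
    (hX : ∀ e ∈ X, IsIdempotentElem e) {j : R} (hj : IsLUB X j) : IsIdempotentElem j := by
  have h1 := hR.mul_isLUB X hXf j hj j
  have h2 : (fun x => j * x) '' X = X := by
    refine (Set.image_congr fun e he => ?_).trans (Set.image_id' X)
    have := le_iff.1 (hj.1 he)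
    rw [idem_inv (hX e he), (hX e he).eq] at this
    exact this.symm
  rw [h2] at h1
  exact h1.unique hj

theorem IsDistributive.exists_isLUB_idem (hR : IsDistributive R)
    (e f : {e : R // IsIdempotentElem e}) :
    ∃ j : {e : R // IsIdempotentElem e}, IsLUB {(e : R), (f : R)} (j : R) := by
  have hX : ∀ x ∈ ({(e : R), (f : R)} : Set R), IsIdempotentElem x := by
    rintro x (rfl | rfl)
    exacts [e.2, f.2]
  obtain ⟨j, hj⟩ := hR.exists_isLUB {(e : R), (f : R)} (Set.toFinite _) (isCompatible_of_idem hX)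
  exact ⟨⟨j, hR.idem_of_isLUB (Set.toFinite _) hX hj⟩, hj⟩

/-- A distributive inverse semigroup is weakly boolean iff its idempotents have relative
complements. -/
theorem IsDistributive.isWeaklyBoolean_iff (hR : IsDistributive R) :
    IsWeaklyBoolean R ↔ ∀ e f : R, IsIdempotentElem e → IsIdempotentElem f →
      ∃ g, IsIdempotentElem g ∧ g * f = 0 ∧ IsLUB {e * f, g} e := by
  constructor
  · rintro ⟨-, B, hB⟩ e f he hf
    let e' : {e : R // IsIdempotentElem e} := ⟨e, he⟩
    let f' : {e : R // IsIdempotentElem e} := ⟨f, hf⟩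
    let z' : {e : R // IsIdempotentElem e} := ⟨0, mul_zero 0⟩
    -- The operations of `B` are known only through its order, so its bottom has to be identified
    -- with `0`.
    have hbot : ((⊥ : {e : R // IsIdempotentElem e}) : R) = 0 := by
      have h1 : B.le (z' \ z') z' := sdiff_le
      rw [sdiff_self] at h1
      exact eq_zero_of_le ((hB _ z').1 h1)
    have hg0 : ((e' \ f' : {e : R // IsIdempotentElem e}) : R) * f = 0 := by
      have h1 : B.le ⟨_, idem_mul (e' \ f').2 hf⟩ (f' ⊓ (e' \ f')) :=
        le_inf ((hB _ f').2 (idem_mul_le f (e' \ f').2)) ((hB _ (e' \ f')).2 (mul_idem_le _ hf))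
      rw [inf_sdiff_self_right] at h1
      have := (hB _ _).1 h1
      rw [hbot] at this
      exact eq_zero_of_le this
    refine ⟨(e' \ f' : {e : R // IsIdempotentElem e}), (e' \ f').2, hg0, ?_, ?_⟩
    · rintro x (rfl | rfl)
      · exact mul_idem_le e hf
      · exact (hB _ e').1 sdiff_le
    · intro u hu
      -- The upper bound `u` need not be idempotent, so it is out of reach of `B`. The join `j` in
      -- `R` is idempotent and lies below `u`, and `B` can compare `e` with it.
      obtain ⟨j, hj⟩ := hR.exists_isLUB_idem ⟨_, idem_mul he hf⟩ (e' \ f')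
      refine le_trans ?_ (hj.2 hu)
      have h1 : B.le e' j := by
        rw [← sup_inf_sdiff e' f']
        refine sup_le ((hB _ j).2 (le_trans ?_ (hj.1 (Or.inl rfl)))) ((hB _ j).2 (hj.1 (Or.inr rfl)))
        exact le_mul_of_idem hf ((hB _ e').1 inf_le_left) ((hB _ f').1 inf_le_right)
      exact (hB e' j).1 h1
  · intro h
    refine ⟨hR, ?_⟩
    choose J hJ using hR.exists_isLUB_idem
    have h' : ∀ e f : {e : R // IsIdempotentElem e}, ∃ g : {e : R // IsIdempotentElem e},
        (g : R) * f = 0 ∧ IsLUB {(e : R) * f, (g : R)} (e : R) := by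
      intro e f
      obtain ⟨g, hg, h1, h2⟩ := h e f e.2 f.2
      exact ⟨⟨g, hg⟩, h1, h2⟩
    choose D hD0 hD using h'
    let L : Lattice {e : R // IsIdempotentElem e} :=
      { (inferInstance : PartialOrder {e : R // IsIdempotentElem e}) with
        sup := J
        inf := fun e f => ⟨e * f, idem_mul e.2 f.2⟩
        le_sup_left := fun e f => (hJ e f).1 (Or.inl rfl)
        le_sup_right := fun e f => (hJ e f).1 (Or.inr rfl)
        sup_le := fun e f g he hf => (hJ e f).2 (by
          rintro x (rfl | rfl)
          exacts [he, hf])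
        inf_le_left := fun e f => mul_idem_le (e : R) f.2
        inf_le_right := fun e f => idem_mul_le (f : R) e.2
        le_inf := fun e f g he hf => le_mul_of_idem g.2 he hf }
    let DL : DistribLattice {e : R // IsIdempotentElem e} :=
      DistribLattice.ofInfSupLe fun a b c => by
        have h1 := hR.mul_isLUB _ (Set.toFinite _) _ (hJ b c) a
        refine h1.2 ?_
        rintro _ ⟨x, rfl | rfl, rfl⟩
        · exact (hJ (a ⊓ b) (a ⊓ c)).1 (Or.inl rfl)
        · exact (hJ (a ⊓ b) (a ⊓ c)).1 (Or.inr rfl)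
    refine ⟨{ DL with
      bot := ⟨0, mul_zero 0⟩
      sdiff := D
      sup_inf_sdiff := fun a b => Subtype.ext ((hJ _ _).unique (hD a b))
      inf_inf_sdiff := fun a b => Subtype.ext ?_ }, fun e f => Iff.rfl⟩
    change (a : R) * b * D a b = 0
    rw [mul_assoc, idem_comm b.2 (D a b).2, hD0, mul_zero]

end Boolean

/-! ### Transfer to the separative quotient and its tight ideals -/

namespace TightQuotient

variable {S : Type*} [InverseSemigroupWithZero S]

/-- A restriction of a class is the class of a restriction: idempotent domains lift along `mk`. -/
theorem exists_le_of_le_mk {x : TightQuotient S} {a : S} (h : x ≤ mk a) : ∃ c ≤ a, mk c = x := by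
  obtain ⟨c, -, hx⟩ := exists_of_le_mk h
  exact ⟨_, mul_idem_le a (idem_inv_mul c), hx.symm⟩

theorem isTightCover_image_mk {X : Set S} {a : S} (h : IsTightCover X a) :
    IsTightCover (mk '' X) (mk a) := by
  refine ⟨h.1.image _, ?_, fun z hz h0 => ?_⟩
  · rintro _ ⟨x, hx, rfl⟩
    exact mk_le_mk (h.2.1 hx)
  · obtain ⟨c, hc, rfl⟩ := exists_le_of_le_mk hz
    obtain ⟨b, hb, u, hu0, huc, hub⟩ := h.2.2 c hc (fun h => h0 (mk_eq_zero.2 h))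
    exact ⟨_, ⟨b, hb, rfl⟩, mk u, fun h => hu0 (mk_eq_zero.1 h), mk_le_mk huc, mk_le_mk hub⟩

end TightQuotient

theorem IsTightClosed.inter {S : Type*} [InverseSemigroupWithZero S] {A B : Set S}
    (hA : IsTightClosed A) (hB : IsTightClosed B) : IsTightClosed (A ∩ B) := fun X x hX hx =>
  ⟨hA X x (hX.trans Set.inter_subset_left) hx, hB X x (hX.trans Set.inter_subset_right) hx⟩

namespace TightIdeal

variable {S : Type*} [InverseSemigroupWithZero S] [TightSeparative S]

/-- Finite elements are the finitely generated ones, and the union of finitely many finite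
generating sets generates the join. -/
theorem isFiniteElement_of_carrier_eq_iUnion {X : Set (TightIdeal S)} (hX : X.Finite)
    (hfin : ∀ A ∈ X, IsFiniteElement A) {J : TightIdeal S}
    (hJ : J.carrier = tightClosure (⋃ A ∈ X, A.carrier)) : IsFiniteElement J := by
  have h : ∀ A : TightIdeal S, ∃ G : Set S, A ∈ X → G ⊆ A.carrier ∧ G.Finite ∧
      A.carrier = tightClosure (lowerClosure G : Set S) := by
    intro A
    by_cases hA : A ∈ X
    · obtain ⟨G, hG⟩ := isFiniteElement_iff.1 (hfin A hA)
      exact ⟨G, fun _ => hG⟩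
    · exact ⟨∅, fun h => absurd h hA⟩
  choose G hG using h
  have hGJ : (⋃ A ∈ X, G A) ⊆ J.carrier := by
    rw [hJ]
    exact (Set.iUnion₂_mono fun A hA => (hG A hA).1).trans (subset_tightClosure _)
  refine isFiniteElement_iff.2 ⟨_, hGJ, hX.biUnion fun A hA => (hG A hA).2.1,
    Set.Subset.antisymm ?_ (J.closed.tightClosure_subset (lowerClosure_min hGJ J.lower))⟩
  rw [hJ]
  refine (isTightClosed_tightClosure _).tightClosure_subset (Set.iUnion₂_subset fun A hA => ?_)
  rw [(hG A hA).2.2]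
  exact tightClosure_mono (lowerClosure_mono (Set.subset_biUnion_of_mem (u := G) hA))

end TightIdeal

/-! ### Joins, meets and complements in the tight completion -/

namespace TightCompletion

open scoped Pointwise

variable {S : Type*} [InverseSemigroupWithZero S]

theorem le_iff_subset {A B : TightCompletion S} : A ≤ B ↔ A.1.carrier ⊆ B.1.carrier := by
  rw [← TightIdeal.le_iff_subset, le_iff, le_iff]
  exact Subtype.ext_iff

theorem isIdempotentElem_iff {A : TightCompletion S} :
    IsIdempotentElem A ↔ ∀ a ∈ A.1.carrier, IsIdempotentElem a := by
  rw [← TightIdeal.isIdempotentElem_iff]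
  exact Subtype.ext_iff

theorem carrier_mul (A B : TightCompletion S) :
    (A * B).1.carrier = tightClosure (A.1.carrier * B.1.carrier) := rfl

theorem isCompatible_image {X : Set (TightCompletion S)} (hX : IsCompatible X) :
    IsCompatible ((fun A : TightCompletion S => A.1) '' X) := by
  rintro _ ⟨A, hA, rfl⟩ _ ⟨B, hB, rfl⟩
  exact ⟨congrArg Subtype.val (hX A hA B hB).1, congrArg Subtype.val (hX A hA B hB).2⟩

theorem isLUB_of_carrier_eq {X : Set (TightCompletion S)} {J : TightCompletion S}
    (hJ : J.1.carrier = tightClosure (⋃ A ∈ X, A.1.carrier)) : IsLUB X J := by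
  refine ⟨fun A hA => le_iff_subset.2 ?_, fun B hB => le_iff_subset.2 ?_⟩
  · rw [hJ]
    exact (Set.subset_biUnion_of_mem (u := fun A : TightCompletion S => A.1.carrier) hA).trans
      (subset_tightClosure _)
  · rw [hJ]
    exact B.1.closed.tightClosure_subset
      (Set.iUnion₂_subset fun A hA => le_iff_subset.1 (hB hA))

theorem exists_carrier_eq {X : Set (TightCompletion S)} (hXf : X.Finite) (hX : IsCompatible X) :
    ∃ J : TightCompletion S, J.1.carrier = tightClosure (⋃ A ∈ X, A.1.carrier) := by
  obtain ⟨J, -, hJ⟩ := TightIdeal.exists_isLUB (isCompatible_image hX)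
  refine ⟨⟨J, TightIdeal.isFiniteElement_of_carrier_eq_iUnion (hXf.image _) ?_ hJ⟩, ?_⟩
  · rintro _ ⟨A, -, rfl⟩
    exact A.2
  · exact hJ.trans (congrArg tightClosure Set.biUnion_image)

/-- A set with an upper bound is compatible, so the closure of the union of its members is an
element, and joins are unique. -/
theorem isLUB_iff {X : Set (TightCompletion S)} (hXf : X.Finite) {J : TightCompletion S} :
    IsLUB X J ↔ J.1.carrier = tightClosure (⋃ A ∈ X, A.1.carrier) := by
  refine ⟨fun h => ?_, isLUB_of_carrier_eq⟩
  obtain ⟨K, hK⟩ := exists_carrier_eq hXf ((isCompatible_Iic J).mono fun A hA => h.1 hA)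
  rw [h.unique (isLUB_of_carrier_eq hK), hK]

variable (S) in
-- Joins are closures of unions. Products of sets distribute over unions, and closing a factor first
-- does not change the closure of a product.
theorem isDistributive : IsDistributive (TightCompletion S) where
  exists_isLUB X hXf hX := by
    obtain ⟨J, hJ⟩ := exists_carrier_eq hXf hX
    exact ⟨J, isLUB_of_carrier_eq hJ⟩
  mul_isLUB X hXf J hJ A := by
    refine isLUB_of_carrier_eq ?_
    rw [carrier_mul, (isLUB_iff hXf).1 hJ, tightClosure_mul_right, Set.biUnion_image]
    refine Set.Subset.antisymm (tightClosure_mono ?_)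
      ((isTightClosed_tightClosure _).tightClosure_subset (Set.iUnion₂_subset fun B hB => ?_))
    · rw [Set.mul_iUnion₂]
      exact Set.iUnion₂_mono fun B hB => subset_tightClosure _
    · exact tightClosure_mono (Set.mul_subset_mul_left
        (Set.subset_biUnion_of_mem (u := fun A : TightCompletion S => A.1.carrier) hB))
  isLUB_mul X hXf J hJ A := by
    refine isLUB_of_carrier_eq ?_
    rw [carrier_mul, (isLUB_iff hXf).1 hJ, tightClosure_mul_left, Set.biUnion_image]
    refine Set.Subset.antisymm (tightClosure_mono ?_)
      ((isTightClosed_tightClosure _).tightClosure_subset (Set.iUnion₂_subset fun B hB => ?_))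
    · rw [Set.iUnion₂_mul]
      exact Set.iUnion₂_mono fun B hB => subset_tightClosure _
    · exact tightClosure_mono (Set.mul_subset_mul_right
        (Set.subset_biUnion_of_mem (u := fun A : TightCompletion S => A.1.carrier) hB))

/-- The weak meet condition makes the tight completion a meet semilattice. -/
theorem exists_isGLB (hS : WeakMeetCondition S) (A B : TightCompletion S) :
    ∃ C, IsGLB {A, B} C := by
  obtain ⟨G, hGA, hGf, hG⟩ := TightIdeal.isFiniteElement_iff.1 A.2
  obtain ⟨H, hHB, hHf, hH⟩ := TightIdeal.isFiniteElement_iff.1 B.2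
  have hr : ∀ x : TightQuotient S, ∃ a, TightQuotient.mk a = x := TightQuotient.mk_surjective
  choose r hr using hr
  choose C hCf hC using hS
  let M : TightIdeal (TightQuotient S) := ⟨A.1.carrier ∩ B.1.carrier, A.1.lower.inter B.1.lower,
    A.1.compatible.mono Set.inter_subset_left, A.1.closed.inter B.1.closed⟩
  -- The meet is the intersection; it remains to generate it finitely. The generators come from the
  -- weak meet condition in `S`, applied to representatives of the generators of `A` and `B`.
  let K : Set (TightQuotient S) := ⋃ g ∈ G, ⋃ h ∈ H, TightQuotient.mk '' C (r g) (r h)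
  have hKM : K ⊆ M.carrier := by
    refine Set.iUnion₂_subset fun g hg => Set.iUnion₂_subset fun h hh => ?_
    rintro _ ⟨c, hc, rfl⟩
    have hc' : c ∈ Set.Iic (r g) ∩ Set.Iic (r h) := hC _ _ ▸ subset_lowerClosure hc
    have h1 := TightQuotient.mk_le_mk hc'.1
    have h2 := TightQuotient.mk_le_mk hc'.2
    rw [hr] at h1 h2
    exact ⟨A.1.lower h1 (hGA hg), B.1.lower h2 (hHB hh)⟩
  have hM : IsFiniteElement M := by
    refine TightIdeal.isFiniteElement_iff.2 ⟨K, hKM,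
      hGf.biUnion fun g _ => hHf.biUnion fun h _ => (hCf _ _).image _,
      Set.Subset.antisymm ?_ (M.closed.tightClosure_subset (lowerClosure_min hKM M.lower))⟩
    rintro x ⟨hxA, hxB⟩
    rw [hG] at hxA
    rw [hH] at hxB
    obtain ⟨X, hX, hXx⟩ := hxA
    obtain ⟨Y, hY, hYx⟩ := hxB
    -- A common refinement of the two coverings of `x`: each `z * (y⁻¹ * y)` is the meet of `y` and
    -- `z`, hence lies below a generator of `A` and a generator of `B`.
    refine isTightClosed_tightClosure _ (⋃ y ∈ X, Y * {y⁻¹ * y}) x ?_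
      (hXx.trans (Y := fun y => Y * {y⁻¹ * y}) fun y hy => ?_)
    · refine Set.iUnion₂_subset fun y hy => ?_
      rw [Set.mul_singleton]
      rintro _ ⟨z, hz, rfl⟩
      obtain ⟨g, hg, hyg⟩ := hX hy
      obtain ⟨h, hh, hzh⟩ := hY hz
      have h1 : z * (y⁻¹ * y) ≤ TightQuotient.mk (r g) := by
        rw [hr]
        exact (mul_idem_le_of_le (hYx.2.1 hz) (hXx.2.1 hy)).trans hyg
      have h2 : z * (y⁻¹ * y) ≤ TightQuotient.mk (r h) := by
        rw [hr]
        exact (mul_idem_le z (idem_inv_mul y)).trans hzh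
      obtain ⟨a, ha, hae⟩ := TightQuotient.exists_le_of_le_mk h1
      obtain ⟨b, hb, hbe⟩ := TightQuotient.exists_le_of_le_mk h2
      -- The lifts `a ≤ r g` and `b ≤ r h` agree only in the quotient. Members of a common tight
      -- covering `Z` lie below both representatives in `S` itself.
      obtain ⟨Z, hZa, hZb⟩ := TightQuotient.mk_eq.1 (hae.trans hbe.symm)
      have hcov := TightQuotient.isTightCover_image_mk hZa
      rw [hae] at hcov
      refine ⟨TightQuotient.mk '' Z, ?_, hcov⟩
      rintro _ ⟨t, ht, rfl⟩
      have hta : t ≤ a := hZa.2.1 ht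
      have htb : t ≤ b := hZb.2.1 ht
      obtain ⟨c, hc, htc⟩ : t ∈ (lowerClosure (C (r g) (r h)) : Set S) :=
        hC _ _ ▸ ⟨hta.trans ha, htb.trans hb⟩
      exact ⟨_, Set.mem_biUnion hg (Set.mem_biUnion hh ⟨c, hc, rfl⟩), TightQuotient.mk_le_mk htc⟩
    · have := hYx.mul (isTightCover_singleton (y⁻¹ * y))
      rwa [← le_iff.1 (hXx.2.1 hy)] at this
  refine ⟨⟨M, hM⟩, ?_, fun D hD => le_iff_subset.2 (Set.subset_inter
    (le_iff_subset.1 (hD (Or.inl rfl))) (le_iff_subset.1 (hD (Or.inr rfl))))⟩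
  rintro D (rfl | rfl)
  · exact le_iff_subset.2 Set.inter_subset_left
  · exact le_iff_subset.2 Set.inter_subset_right

theorem isBoolean_iff (hS : WeakMeetCondition S) : IsBoolean (TightCompletion S) ↔
    ∀ A B : TightCompletion S, IsIdempotentElem A → IsIdempotentElem B →
      ∃ C, IsIdempotentElem C ∧ C * B = 0 ∧ IsLUB {A * B, C} A :=
  (and_iff_left (exists_isGLB hS)).trans (isDistributive S).isWeaklyBoolean_iff

theorem exists_of_idem {G : Set (TightQuotient S)} (hGf : G.Finite)
    (hG : ∀ g ∈ G, IsIdempotentElem g) : ∃ A : TightCompletion S,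
      IsIdempotentElem A ∧ A.1.carrier = tightClosure (lowerClosure G : Set (TightQuotient S)) := by
  have h : ∀ g ∈ (lowerClosure G : Set (TightQuotient S)), IsIdempotentElem g := by
    rintro x ⟨g, hg, hx⟩
    exact idem_of_le hx (hG g hg)
  refine ⟨⟨TightIdeal.ofIdeal _ (lowerClosure G).lower (isCompatible_of_idem h),
    TightIdeal.isFiniteElement_iff.2 ⟨G, ?_, hGf, rfl⟩⟩, ?_, rfl⟩
  · exact subset_lowerClosure.trans (subset_tightClosure _)
  · exact isIdempotentElem_iff.2 fun a ha => isIdempotentElem_of_mem_tightClosure h ha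

/-- Complement the part of `B` inside each generator `g` of `A` separately, working with idempotent
representatives in `S`; the classes of all these complements generate `C`. -/
theorem exists_compl_of_isTightCover
    (h : ∀ (e : S) (X : Set S), IsIdempotentElem e → X.Finite →
      (∀ f ∈ X, IsIdempotentElem f ∧ f ≤ e) → ∃ Y : Set S, Y.Finite ∧
        (∀ g ∈ Y, IsIdempotentElem g ∧ g ≤ e) ∧ IsTightCover (X ∪ Y) e ∧
          ∀ g ∈ Y, ∀ f ∈ X, g * f = 0)
    {A B : TightCompletion S} (hA : IsIdempotentElem A) (hB : IsIdempotentElem B) :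
    ∃ C, IsIdempotentElem C ∧ C * B = 0 ∧ IsLUB {A * B, C} A := by
  obtain ⟨G, hGA, hGf, hG⟩ := TightIdeal.isFiniteElement_iff.1 A.2
  obtain ⟨H, hHB, hHf, hH⟩ := TightIdeal.isFiniteElement_iff.1 B.2
  rw [isIdempotentElem_iff] at hA hB
  -- The junk value `0` keeps `r x` idempotent for every `x`, so that `h` applies without membership
  -- hypotheses.
  have hr : ∀ x : TightQuotient S, ∃ e : S, IsIdempotentElem e ∧
      (IsIdempotentElem x → TightQuotient.mk e = x) := by
    intro x
    by_cases hx : IsIdempotentElem x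
    · obtain ⟨e, he, hex⟩ := TightQuotient.exists_idem hx
      exact ⟨e, he, fun _ => hex⟩
    · exact ⟨0, mul_zero 0, fun h => absurd h hx⟩
  choose r hri hr using hr
  have hrA : ∀ g ∈ G, TightQuotient.mk (r g) = g := fun g hg => hr g (hA g (hGA hg))
  have hrB : ∀ g ∈ H, TightQuotient.mk (r g) = g := fun g hg => hr g (hB g (hHB hg))
  have h' := fun g : TightQuotient S => h (r g) ((fun x => r g * r x) '' H) (hri g) (hHf.image _) (by
    rintro _ ⟨x, -, rfl⟩
    exact ⟨idem_mul (hri g) (hri x), mul_idem_le _ (hri x)⟩)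
  choose Y hYf hY hcov h0 using h'
  obtain ⟨C, hC, hCc⟩ := exists_of_idem (G := ⋃ g ∈ G, TightQuotient.mk '' Y g)
    (hGf.biUnion fun g _ => (hYf g).image _) (by
      intro x hx
      simp only [Set.mem_iUnion] at hx
      obtain ⟨g, -, y, hy, rfl⟩ := hx
      exact congrArg TightQuotient.mk (hY g y hy).1)
  refine ⟨C, hC, Subtype.ext ?_, isLUB_of_carrier_eq ?_⟩
  · refine TightIdeal.ext (Set.Subset.antisymm ?_
      (Set.singleton_subset_iff.2 (C * B).1.zero_mem))
    rw [carrier_mul, hCc, hH, tightClosure_mul_left, tightClosure_mul_right]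
    refine (0 : TightIdeal (TightQuotient S)).closed.tightClosure_subset ?_
    rintro _ ⟨x, ⟨_, hk, hxk⟩, z, ⟨b, hb, hzb⟩, rfl⟩
    simp only [Set.mem_iUnion] at hk
    obtain ⟨g, hg, y, hy, rfl⟩ := hk
    -- As `y ≤ r g`, the product `y * r b` equals `y * (r g * r b)`, which is zero by orthogonality.
    have h1 : y * r b = 0 := by
      rw [← h0 g y hy _ ⟨b, hb, rfl⟩, ← mul_assoc]
      have := le_iff.1 (hY g y hy).2
      rw [idem_inv (hY g y hy).1, (hY g y hy).1.eq, idem_comm (hri g) (hY g y hy).1] at this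
      rw [← this]
    have h2 : x * z ≤ TightQuotient.mk (y * r b) := by
      rw [TightQuotient.mk_mul, hrB b hb]
      exact mul_le_mul hxk hzb
    rw [h1] at h2
    exact eq_zero_of_le h2
  · rw [Set.biUnion_pair]
    refine Set.Subset.antisymm ?_ (A.1.closed.tightClosure_subset (Set.union_subset
      (le_iff_subset.1 (mul_idem_le A (isIdempotentElem_iff.2 hB))) ?_))
    · rw [hG]
      refine (isTightClosed_tightClosure _).tightClosure_subset (lowerClosure_min ?_
        (isLowerSet_tightClosure ((A * B).1.lower.union C.1.lower)))
      intro g hg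
      -- The image of the covering of `r g` splits into the products `g * b`, in `A * B`, and the
      -- classes of `Y g`, in `C`.
      refine ⟨TightQuotient.mk '' ((fun x => r g * r x) '' H ∪ Y g), ?_, ?_⟩
      · rintro _ ⟨_, ⟨b, hb, rfl⟩ | hy, rfl⟩
        · refine Or.inl (subset_tightClosure _ ⟨g, hGA hg, b, hHB hb, ?_⟩)
          change g * b = TightQuotient.mk (r g * r b)
          rw [TightQuotient.mk_mul, hrA g hg, hrB b hb]
        · refine Or.inr ?_
          rw [hCc]
          exact subset_tightClosure _ (subset_lowerClosure (Set.mem_biUnion hg ⟨_, hy, rfl⟩))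
      · have := TightQuotient.isTightCover_image_mk (hcov g)
        rwa [hrA g hg] at this
    · rw [hCc]
      refine A.1.closed.tightClosure_subset (lowerClosure_min ?_ A.1.lower)
      refine Set.iUnion₂_subset fun g hg => ?_
      rintro _ ⟨y, hy, rfl⟩
      refine A.1.lower ?_ (hGA hg)
      rw [← hrA g hg]
      exact TightQuotient.mk_le_mk (hY g y hy).2

/-- The complement of the ideal of `mk f` in that of `mk e` is finite, hence finitely generated; its
generators lift to idempotents of `S`. -/
theorem exists_isTightCover_of_compl
    (h : ∀ A B : TightCompletion S, IsIdempotentElem A → IsIdempotentElem B →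
      ∃ C, IsIdempotentElem C ∧ C * B = 0 ∧ IsLUB {A * B, C} A)
    {e f : S} (he : IsIdempotentElem e) (hf : IsIdempotentElem f) (hfe : f ≤ e) :
    ∃ Y : Set S, Y.Finite ∧ (∀ g ∈ Y, IsIdempotentElem g ∧ g ≤ e) ∧ IsTightCover ({f} ∪ Y) e ∧
      ∀ g ∈ Y, g * f = 0 := by
  have hme : IsIdempotentElem (TightQuotient.mk e) := congrArg TightQuotient.mk he
  have hmf : IsIdempotentElem (TightQuotient.mk f) := congrArg TightQuotient.mk hf
  obtain ⟨A, hA, hAc⟩ := exists_of_idem (Set.finite_singleton (TightQuotient.mk e))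
    (by rintro _ rfl; exact hme)
  obtain ⟨B, hB, hBc⟩ := exists_of_idem (Set.finite_singleton (TightQuotient.mk f))
    (by rintro _ rfl; exact hmf)
  obtain ⟨C, hC, hCB, hCA⟩ := h A B hA hB
  obtain ⟨G, hGC, hGf, hG⟩ := TightIdeal.isFiniteElement_iff.1 C.2
  have hGi : ∀ g ∈ G, IsIdempotentElem g := fun g hg => isIdempotentElem_iff.1 hC g (hGC hg)
  have hfB : TightQuotient.mk f ∈ B.1.carrier := by
    rw [hBc]
    exact subset_tightClosure _ (subset_lowerClosure rfl)
  have heA : TightQuotient.mk e ∈ A.1.carrier := by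
    rw [hAc]
    exact subset_tightClosure _ (subset_lowerClosure rfl)
  have hsub : A.1.carrier ⊆
      tightClosure (lowerClosure ({TightQuotient.mk f} ∪ G) : Set (TightQuotient S)) := by
    rw [(isLUB_iff (Set.toFinite _)).1 hCA, Set.biUnion_pair]
    refine (isTightClosed_tightClosure _).tightClosure_subset (Set.union_subset
      ((le_iff_subset.1 (idem_mul_le B hA)).trans ?_) ?_)
    · rw [hBc]
      exact tightClosure_mono (lowerClosure_mono Set.subset_union_left)
    · rw [hG]
      exact tightClosure_mono (lowerClosure_mono Set.subset_union_right)
  obtain ⟨X, hX, hXe⟩ := hsub heA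
  choose r hri hr using fun g : G => TightQuotient.exists_idem (hGi g g.2)
  have := hGf.to_subtype
  -- The lifts `r g` need not lie below `e` in `S`; multiplying by `e` repairs this.
  refine ⟨Set.range fun g => e * r g, Set.finite_range _, ?_, ⟨?_, ?_, ?_⟩, ?_⟩
  · rintro _ ⟨g, rfl⟩
    exact ⟨idem_mul he (hri g), mul_idem_le e (hri g)⟩
  · exact (Set.finite_singleton f).union (Set.finite_range _)
  · rintro _ (rfl | ⟨g, rfl⟩)
    exacts [hfe, mul_idem_le e (hri g)]
  · intro z hz h0
    have hzi := idem_of_le hz he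
    obtain ⟨x, hx, u, hu0, huz, hux⟩ := hXe.2.2 (TightQuotient.mk z) (TightQuotient.mk_le_mk hz)
      (fun h => h0 (TightQuotient.mk_eq_zero.1 h))
    -- A nonzero lower bound `u` in the quotient is replaced by the product `z * k` in `S`, whose
    -- class lies above `u`.
    have key : ∀ k : S, IsIdempotentElem k → u ≤ TightQuotient.mk k → z * k ≠ 0 := by
      intro k hk huk hzk
      have hk' : IsIdempotentElem (TightQuotient.mk k) := congrArg TightQuotient.mk hk
      have h1 := le_mul_of_idem hk' huz huk
      rw [← TightQuotient.mk_mul, hzk] at h1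
      exact hu0 (eq_zero_of_le h1)
    obtain ⟨g, rfl | hg, hxg⟩ := hX hx
    · exact ⟨f, Or.inl rfl, z * f, key f hf (hux.trans hxg), mul_idem_le z hf, idem_mul_le f hzi⟩
    · refine ⟨_, Or.inr ⟨⟨g, hg⟩, rfl⟩, z * r ⟨g, hg⟩, key _ (hri _) ?_, mul_idem_le z (hri _),
        mul_le_mul hz le_rfl⟩
      rw [hr]
      exact hux.trans hxg
  · rintro _ ⟨g, rfl⟩
    have h1 : (g : TightQuotient S) * TightQuotient.mk f ∈ (C * B).1.carrier :=
      subset_tightClosure _ ⟨_, hGC g.2, _, hfB, rfl⟩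
    -- The zero ideal is `{0}`, and only `0` has class zero, so orthogonality descends to `S`.
    rw [hCB] at h1
    have h2 : TightQuotient.mk (r g * f) = 0 := by
      rw [TightQuotient.mk_mul, hr]
      exact h1
    change e * r g * f = 0
    rw [mul_assoc, TightQuotient.mk_eq_zero.1 h2, mul_zero]

end TightCompletion

end InvSem

/-! ### The equivalences -/

theorem theorem5p19 {S : Type*} [InverseSemigroupWithZero S] (hS : InvSem.WeakMeetCondition S) :
    List.TFAE [
      InvSem.CompactnessCondition S,
      ∀ x : S, IsCompact (InvSem.ultraBasic x ∅),
      ∀ (x : S) (X : Set S), X.Finite → (∀ y ∈ X, y ≤ x) → IsCompact (InvSem.ultraBasic x X),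
      ∀ (e : S) (X : Set S), IsIdempotentElem e → X.Finite →
        (∀ f ∈ X, IsIdempotentElem f ∧ f ≤ e) →
        ∃ Y : Set S, Y.Finite ∧ (∀ g ∈ Y, IsIdempotentElem g ∧ g ≤ e) ∧
          InvSem.ultraBasic e X = ⋃ g ∈ Y, InvSem.ultraBasic g ∅,
      ∀ e f : S, IsIdempotentElem e → IsIdempotentElem f → f ≤ e →
        (InvSem.ultraBasic e {f}).Nonempty →
        ∃ Y : Set S, Y.Finite ∧ (∀ g ∈ Y, IsIdempotentElem g ∧ g ≤ e) ∧
          InvSem.ultraBasic e {f} = ⋃ g ∈ Y, InvSem.ultraBasic g ∅,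
      InvSem.IsBoolean (InvSem.TightCompletion S)] := by
  have hsing : ∀ {e f : S}, IsIdempotentElem f → f ≤ e →
      ∀ g ∈ ({f} : Set S), IsIdempotentElem g ∧ g ≤ e := by
    rintro e f hf hfe g rfl
    exact ⟨hf, hfe⟩
  tfae_have 1 → 2 := fun h x => h.isCompact_ultraBasic hS x
  tfae_have 2 → 3 := fun h x X _ _ => InvSem.isCompact_ultraBasic_of_empty (h x) X
  tfae_have 3 → 4 := fun h e X he hX hXe => InvSem.exists_ultraBasic_eq_iUnion he hX
    (fun f hf => (hXe f hf).2) (h e X hX fun f hf => (hXe f hf).2)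
  tfae_have 4 → 5 := fun h e f he hf hfe _ => h e {f} he (Set.finite_singleton f) (hsing hf hfe)
  tfae_have 5 → 1 := by
    refine fun h => InvSem.compactnessCondition_of_isTightCover fun e f he hf hfe => ?_
    have h' : ∃ Y : Set S, Y.Finite ∧ (∀ g ∈ Y, IsIdempotentElem g ∧ g ≤ e) ∧
        InvSem.ultraBasic e {f} = ⋃ g ∈ Y, InvSem.ultraBasic g ∅ := by
      -- The case excluded by the nonemptiness assumption is the empty union.
      rcases (InvSem.ultraBasic e {f}).eq_empty_or_nonempty with h0 | h0
      · exact ⟨∅, Set.finite_empty, by simp, by simpa using h0⟩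
      · exact h e f he hf hfe h0
    obtain ⟨Y, hYf, hY, hYe⟩ := h'
    obtain ⟨h1, h2⟩ := (InvSem.ultraBasic_eq_iUnion_iff (Set.finite_singleton f)
      (hsing hf hfe) hYf hY).1 hYe
    exact ⟨Y, h1, fun g hg => ⟨(hY g hg).1, h2 g hg f rfl⟩⟩
  -- An idempotent of the completion may need several generators, so finite sets have to be
  -- complemented, not just a single `f`.
  tfae_have 4 → 6 := by
    refine fun h => (InvSem.TightCompletion.isBoolean_iff hS).2 fun A B hA hB =>
      InvSem.TightCompletion.exists_compl_of_isTightCover (fun e X he hX hXe => ?_) hA hB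
    obtain ⟨Y, hYf, hY, hYe⟩ := h e X he hX hXe
    exact ⟨Y, hYf, hY, (InvSem.ultraBasic_eq_iUnion_iff hX hXe hYf hY).1 hYe⟩
  tfae_have 6 → 5 := by
    intro h e f he hf hfe _
    obtain ⟨Y, hYf, hY, h1, h2⟩ := InvSem.TightCompletion.exists_isTightCover_of_compl
      ((InvSem.TightCompletion.isBoolean_iff hS).1 h) he hf hfe
    refine ⟨Y, hYf, hY, (InvSem.ultraBasic_eq_iUnion_iff (Set.finite_singleton f)
      (hsing hf hfe) hYf hY).2 ⟨h1, ?_⟩⟩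
    rintro g hg _ rfl
    exact h2 g hg
  tfae_finish
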